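/- Let $\mathbb K$ be an algebraically closed field and let $\mathbf q=(q_{ij})$ be an $n\times n$ matrix over $\mathbb K^*$ with $q_{ii}=1$ and $q_{ji}=q_{ij}^{-1}$. Let $\mathcal O_{\mathbf q}(\mathbb K^n)$ be the $\mathbb K$-algebra generated by $x_1,\dots,x_n$ with relations $x_ix_j=q_{ij}x_jx_i$, and let $\mathbb A_{\mathbf q}$ (the quantum torus) be the $\mathbb K$-algebra generated by $x_1^{\pm1},\dots,x_n^{\pm1}$ with the same relations. Assume that the $q_{ij}$ generate a finite (hence cyclic) subgroup of $\mathbb K^*$, of order $m$, and let $q$ be a generator of it. Modules are right modules. A normal form of $\mathbb A_{\mathbf q}$ consists of an integer $s\ge 0$ with $2s\le n$, divisors $h_1=1\mid h_2\mid\dots\mid h_s$ of $m$ with $h_i\ne m$ for $i\ge2$, an integer $z\ge1$ with $\operatorname{ord}(q^{zh_s})=\operatorname{ord}(q^{h_s})$ (if $s\ge 1$) and with $z=1$ if $2s<n$, and an isomorphism of $\mathbb K$-algebras $$\mathbb A_{\mathbf q}\cong \mathbb A_{c_1}\otimes\cdots\otimes\mathbb A_{c_s}\otimes\mathbb K[\mathbb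 Z^{n-2s}],\qquad c_i=q^{h_i}\ (i<s),\quad c_s=q^{zh_s},$$ where $\mathbb A_{c_i}$ is generated by $X_i^{\pm1},X_{i+s}^{\pm1}$ with $X_iX_{i+s}=c_iX_{i+s}X_i$, and $\mathbb K[\mathbb Z^{n-2s}]$ is generated by $X_{2s+1}^{\pm1},\dots,X_n^{\pm1}$. Put $k_i=m/h_i$. For $\alpha\in(\mathbb K^*)^n$ let $M(\alpha)$ be the $\mathbb A_{\mathbf q}$-module with $\mathbb K$-basis $e(a_1,\dots,a_s)$, $0\le a_i\le k_i-1$, and action $$e(a)X_i=\alpha_i\,e(\dots,a_i+1,\dots),\qquad e(a)X_{i+s}=\alpha_i^{-1}\alpha_{i+s}\,c_i^{\,a_i-1}\,e(\dots,a_i-1,\dots),\qquad e(a)X_{2s+j}=\alpha_{2s+j}\,e(a)$$ for $1\le i\le s$ and $1\le j\le n-2s$, where $a_i\pm1$ is taken modulo $k_i$. Then $\mathbb A_{\mathbf q}$ has a normal form. Moreover, for every normal form the following hold. Let $N$ be a simple $\mathcal O_{\mathbf q}(\mathbb K^n)$-module on which every $x_i$ acts nontrivially (i.e. $Nx_i\neq0$).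 Then the module structure of $N$ extends uniquely to an $\mathbb A_{\mathbf q}$-module structure; with it $N$ is a simple $\mathbb A_{\mathbf q}$-module, and $N\cong M(\alpha)$ as an $\mathbb A_{\mathbf q}$-module for some $\alpha\in(\mathbb K^*)^n$. Conversely, each $M(\alpha)$, $\alpha\in(\mathbb K^*)^n$, is simple as an $\mathcal O_{\mathbf q}(\mathbb K^n)$-module, and every $x_i$ acts nontrivially on it; thus $\alpha\mapsto M(\alpha)$ is a surjection from $(\mathbb K^*)^n$ onto the set of isomorphism classes of simple $\mathcal O_{\mathbf q}(\mathbb K^n)$-modules on which all $x_i$ act nontrivially. -/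

import Mathlib

open MulOpposite

noncomputable section

namespace QuantumSpace

universe u

section Algebras

variable {K : Type u} [Field K] {ι : Type} (q : Matrix ι ι Kˣ)

/-- A matrix of nonzero scalars is multiplicatively antisymmetric if `q i i = 1` for all `i` and
`q j i = (q i j)⁻¹` for all `i ≠ j`. -/
def MultAntisymm : Prop :=
  (∀ i, q i i = 1) ∧ ∀ i j, i ≠ j → q j i = (q i j)⁻¹

/-- The subgroup of `Kˣ` generated by the entries of `q`. -/
def paramGroup : Subgroup Kˣ :=
  Subgroup.closure (Set.range fun p : ι × ι => q p.1 p.2)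

/-- The defining relations `x i * x j = q i j • (x j * x i)` of the quantum affine space. -/
inductive AffineRel : FreeAlgebra K ι → FreeAlgebra K ι → Prop
  | comm (i j : ι) : AffineRel (FreeAlgebra.ι K i * FreeAlgebra.ι K j)
      ((q i j : K) • (FreeAlgebra.ι K j * FreeAlgebra.ι K i))

/-- The coordinate ring of quantum affine space with parameter matrix `q`. -/
def QuantumAffine : Type u := RingQuot (AffineRel q)

instance : Ring (QuantumAffine q) := inferInstanceAs (Ring (RingQuot (AffineRel q)))

instance : Algebra K (QuantumAffine q) := inferInstanceAs (Algebra K (RingQuot (AffineRel q)))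

/-- The generators of the quantum affine space. -/
def QuantumAffine.x (i : ι) : QuantumAffine q :=
  RingQuot.mkAlgHom K (AffineRel q) (FreeAlgebra.ι K i)

/-- The defining relations of the quantum torus. The generators are `x i`, indexed by
`Sum.inl i`, and their inverses, indexed by `Sum.inr i`. -/
inductive TorusRel : FreeAlgebra K (ι ⊕ ι) → FreeAlgebra K (ι ⊕ ι) → Prop
  | comm (i j : ι) : TorusRel (FreeAlgebra.ι K (Sum.inl i) * FreeAlgebra.ι K (Sum.inl j))
      ((q i j : K) • (FreeAlgebra.ι K (Sum.inl j) * FreeAlgebra.ι K (Sum.inl i)))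
  | mul_inv (i : ι) : TorusRel (FreeAlgebra.ι K (Sum.inl i) * FreeAlgebra.ι K (Sum.inr i)) 1
  | inv_mul (i : ι) : TorusRel (FreeAlgebra.ι K (Sum.inr i) * FreeAlgebra.ι K (Sum.inl i)) 1

/-- The quantum torus with parameter matrix `q`: the algebra generated by the `x i` together with
their inverses, subject to the relations `x i * x j = q i j • (x j * x i)`. -/
def QuantumTorus : Type u := RingQuot (TorusRel q)

instance : Ring (QuantumTorus q) := inferInstanceAs (Ring (RingQuot (TorusRel q)))

instance : Algebra K (QuantumTorus q) := inferInstanceAs (Algebra K (RingQuot (TorusRel q)))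

/-- The generators of the quantum torus. -/
def QuantumTorus.x (i : ι) : QuantumTorus q :=
  RingQuot.mkAlgHom K (TorusRel q) (FreeAlgebra.ι K (Sum.inl i))

/-- The canonical map from the quantum affine space to the quantum torus, `x i ↦ x i`. -/
def toTorus : QuantumAffine q →ₐ[K] QuantumTorus q :=
  RingQuot.liftAlgHom K ⟨FreeAlgebra.lift K (QuantumTorus.x q), by
    rintro _ _ ⟨i, j⟩
    simp only [map_mul, map_smul, FreeAlgebra.lift_ι_apply, QuantumTorus.x]
    have h := RingQuot.mkAlgHom_rel K (TorusRel.comm (q := q) i j)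
    rw [map_mul, map_smul, map_mul] at h
    exact h⟩

variable {q}

/-- The algebra map out of the quantum torus determined by invertible elements that satisfy
the commutation relations. -/
def QuantumTorus.lift {B : Type*} [Ring B] [Algebra K B] (f : ι → Bˣ)
    (hf : ∀ i j, (f i * f j : B) = (q i j : K) • (f j * f i : B)) : QuantumTorus q →ₐ[K] B :=
  RingQuot.liftAlgHom K
    ⟨FreeAlgebra.lift K (Sum.elim (fun i => (f i : B)) fun i => ((f i)⁻¹ : Bˣ)), by
      rintro _ _ (⟨i, j⟩ | i | i)
      · simpa using hf i j
      · simp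
      · simp⟩

end Algebras

section WeightedShift

variable {K : Type u} [Field K] {I : Type} [AddCommGroup I]

/-- The linear map `e a ↦ w a • e (a + d)` on the vector space with basis `e a`, `a : I`. -/
def shiftMap (w : I → Kˣ) (d : I) : Module.End K (I →₀ K) :=
  Finsupp.linearCombination K fun a => Finsupp.single (a + d) (w a : K)

lemma shiftMap_single (w : I → Kˣ) (d a : I) (r : K) :
    shiftMap w d (Finsupp.single a r) = Finsupp.single (a + d) (r * w a) := by
  simp [shiftMap]

/-- The map `e a ↦ w a • e (a + d)` as an invertible operator acting from the right. -/
def shiftUnit (w : I → Kˣ) (d : I) : ((Module.End K (I →₀ K))ᵐᵒᵖ)ˣ where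
  val := op (shiftMap w d)
  inv := op (shiftMap (fun a => (w (a - d))⁻¹) (-d))
  val_inv := by
    rw [← op_mul, ← op_one]
    congr 1
    ext a b
    simp [shiftMap_single]
  inv_val := by
    rw [← op_mul, ← op_one]
    congr 1
    ext a b
    simp [shiftMap_single, sub_eq_add_neg]

lemma shiftUnit_comm (w w' : I → Kˣ) (d d' : I) (r : Kˣ)
    (h : ∀ a, w a * w' (a + d) = r * (w' a * w (a + d'))) :
    (shiftUnit w d * shiftUnit w' d' : (Module.End K (I →₀ K))ᵐᵒᵖ) =
      (r : K) • (shiftUnit w' d' * shiftUnit w d : (Module.End K (I →₀ K))ᵐᵒᵖ) := by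
  simp only [shiftUnit, ← op_mul, ← op_smul]
  congr 1
  refine Finsupp.lhom_ext fun a t => ?_
  have h' := congrArg (Units.val) (h a)
  simp only [Units.val_mul] at h'
  simp only [Module.End.mul_apply, LinearMap.smul_apply, shiftMap_single, Finsupp.smul_single,
    smul_eq_mul, add_right_comm a d' d]
  congr 1
  rw [mul_assoc, h']
  ring

end WeightedShift

section Model

variable {K : Type u} [Field K] {s t : ℕ}

/-- Indices of the generators of a tensor product of `s` quantum tori of rank two with the group
algebra of `ℤ ^ t`. The pair `Sum.inl i`, `Sum.inr (Sum.inl i)` belongs to the `i`-th quantum torus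
of rank two, and `Sum.inr (Sum.inr j)` to the group algebra. -/
abbrev BlockIndex (s t : ℕ) : Type := Fin s ⊕ (Fin s ⊕ Fin t)

/-- The parameter matrix of the tensor product of the quantum tori of rank two given by
`X * Y = c i • (Y * X)`, for `i : Fin s`, and of the group algebra of `ℤ ^ t`: generators that belong
to different factors commute. -/
def blockMatrix (c : Fin s → Kˣ) : Matrix (BlockIndex s t) (BlockIndex s t) Kˣ
  | Sum.inl i, Sum.inr (Sum.inl j) => if i = j then c i else 1
  | Sum.inr (Sum.inl i), Sum.inl j => if i = j then (c i)⁻¹ else 1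
  | _, _ => 1

/-- The displacement `d` in the rule that the generator sends `e a` to a multiple of `e (a + d)`. -/
def blockShift (k : Fin s → ℕ) : BlockIndex s t → ∀ i, ZMod (k i)
  | Sum.inl i => Pi.single i 1
  | Sum.inr (Sum.inl i) => Pi.single i (-1)
  | Sum.inr (Sum.inr _) => 0

/-- The coefficient in the rule that the generator sends `e a` to a multiple of `e (a + d)`. The
cast is the representative of `a i` in `{0, …, k i - 1}`. -/
def blockCoeff (k : Fin s → ℕ) (c : Fin s → Kˣ) (α : BlockIndex s t → Kˣ) :
    BlockIndex s t → (∀ i, ZMod (k i)) → Kˣ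
  | Sum.inl i, _ => α (Sum.inl i)
  | Sum.inr (Sum.inl i), a =>
      (α (Sum.inl i))⁻¹ * α (Sum.inr (Sum.inl i)) * c i ^ (((a i).cast : ℤ) - 1)
  | Sum.inr (Sum.inr j), _ => α (Sum.inr (Sum.inr j))

lemma zpow_cast_add {k : ℕ} {c : Kˣ} (hc : c ^ k = 1) (x : ZMod k) (y : ℤ) :
    c ^ ((x + y : ZMod k).cast : ℤ) = c ^ (x.cast + y : ℤ) := by
  have h : (((x + y : ZMod k).cast : ℤ) : ZMod k) = ((x.cast + y : ℤ) : ZMod k) := by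
    push_cast
    simp
  rw [ZMod.intCast_eq_intCast_iff_dvd_sub] at h
  obtain ⟨r, hr⟩ := h
  rw [eq_add_of_sub_eq hr, zpow_add, zpow_mul, zpow_natCast, hc, one_zpow, one_mul]

lemma block_comm (k : Fin s → ℕ) (c : Fin s → Kˣ) (hc : ∀ i, c i ^ k i = 1)
    (α : BlockIndex s t → Kˣ) (x y : BlockIndex s t) (a : ∀ i, ZMod (k i)) :
    blockCoeff k c α x a * blockCoeff k c α y (a + blockShift k x) =
      blockMatrix c x y * (blockCoeff k c α y a * blockCoeff k c α x (a + blockShift k y)) := by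
  have key (i : Fin s) : c i ^ (((a i + 1).cast : ℤ) - 1) = c i * c i ^ (((a i).cast : ℤ) - 1) := by
    have h := zpow_cast_add (hc i) (a i) 1
    rw [Int.cast_one] at h
    rw [zpow_sub, h, ← zpow_sub, ← zpow_one_add]
    congr 1
    ring
  rcases x with i | i | i <;> rcases y with j | j | j <;>
    simp only [blockCoeff, blockShift, blockMatrix, one_mul, add_zero, Pi.add_apply, Pi.zero_apply]
  · exact mul_comm _ _
  · split_ifs with h
    · subst h
      rw [Pi.single_eq_same, key]
      simp only [mul_assoc, mul_comm, mul_left_comm]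
    · rw [Pi.single_eq_of_ne (Ne.symm h), add_zero, one_mul]
      simp only [mul_comm]
  · exact mul_comm _ _
  · split_ifs with h
    · subst h
      rw [Pi.single_eq_same, key]
      rw [eq_inv_mul_iff_mul_eq]
      simp only [mul_assoc, mul_comm, mul_left_comm]
    · rw [Pi.single_eq_of_ne h, add_zero, one_mul]
      simp only [mul_comm]
  · rcases eq_or_ne i j with h | h
    · subst h
      rfl
    · rw [Pi.single_eq_of_ne h, Pi.single_eq_of_ne (Ne.symm h), add_zero, add_zero]
      exact mul_comm _ _
  all_goals exact mul_comm _ _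

/-- The right action of the quantum torus with parameter matrix `blockMatrix c` on the vector space
with basis `e a`, `a : ∀ i, ZMod (k i)`, given by
* `e a * X i = α i • e (a + single i 1)`,
* `e a * Y i = ((α i)⁻¹ * α (s + i) * c i ^ (a i - 1)) • e (a - single i 1)`,
* `e a * Z j = α (2 s + j) • e a`. -/
def blockRep (k : Fin s → ℕ) (c : Fin s → Kˣ) (hc : ∀ i, c i ^ k i = 1)
    (α : BlockIndex s t → Kˣ) :
    QuantumTorus (blockMatrix (t := t) c) →ₐ[K] (Module.End K ((∀ i, ZMod (k i)) →₀ K))ᵐᵒᵖ :=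
  QuantumTorus.lift (B := (Module.End K ((∀ i, ZMod (k i)) →₀ K))ᵐᵒᵖ)
    (fun x => shiftUnit (blockCoeff k c α x) (blockShift k x))
    fun x y => shiftUnit_comm _ _ _ _ _ (block_comm k c hc α x y)

end Model

section NormalForms

variable {K : Type u} [Field K] {n : ℕ}

/-- The exponents `h 1, …, h (s-1), z * h s` of the rank two factors. -/
def exponent {s : ℕ} (h : Fin s → ℕ) (z : ℕ) (i : Fin s) : ℕ :=
  if i.val + 1 = s then z * h i else h i

/-- A normal form of the quantum torus with parameter matrix `q`, relative to the generator `ζ` of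
the group of parameters: an isomorphism of this quantum torus with the tensor product of the rank
two quantum tori with parameters `ζ ^ h 1, …, ζ ^ h (s-1), ζ ^ (z * h s)` and of the group algebra
of `ℤ ^ (n - 2 s)`, where `h 1 = 1`, the `h i` are divisors of the order of `ζ`, nonzero modulo
this order for `i ≥ 2`, each divides the next one, and `z = 1` unless `2 s = n`.
The index set `Fin s` starts at `0`. -/
structure NormalForm (q : Matrix (Fin n) (Fin n) Kˣ) (ζ : Kˣ) where
  s : ℕ
  two_mul_le : 2 * s ≤ n
  h : Fin s → ℕ
  h_dvd_order : ∀ i, h i ∣ orderOf ζ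
  h_first : ∀ i, i.val = 0 → h i = 1
  h_ne_zero : ∀ i, i.val ≠ 0 → ¬ orderOf ζ ∣ h i
  h_dvd : ∀ i j, i ≤ j → h i ∣ h j
  z : ℕ
  z_pos : 0 < z
  z_eq_one : 2 * s < n → z = 1
  z_order : ∀ i : Fin s, i.val + 1 = s → orderOf (ζ ^ (z * h i)) = orderOf (ζ ^ h i)
  iso : QuantumTorus (blockMatrix (t := n - 2 * s) fun i => ζ ^ exponent h z i) ≃ₐ[K]
    QuantumTorus q

namespace NormalForm

variable {q : Matrix (Fin n) (Fin n) Kˣ} {ζ : Kˣ} (F : NormalForm q ζ)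

/-- The numbers `k i = m / h i`, where `m` is the order of `ζ`. -/
def k (i : Fin F.s) : ℕ := orderOf ζ / F.h i

/-- The parameters of the rank two factors. -/
abbrev c : Fin F.s → Kˣ := fun i => ζ ^ exponent F.h F.z i

lemma c_pow_k (i : Fin F.s) : F.c i ^ F.k i = 1 := by
  have h : ζ ^ (F.h i * F.k i) = 1 := by
    rw [k, Nat.mul_div_cancel' (F.h_dvd_order i), pow_orderOf_eq_one]
  change (ζ ^ exponent F.h F.z i) ^ F.k i = 1
  unfold exponent
  split_ifs
  · rw [← pow_mul, mul_assoc, mul_comm, pow_mul, h, one_pow]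
  · rw [← pow_mul, h]

/-- The numbering `X 1, …, X n` of the generators of the normal form: `i ↦ i` and `i ↦ s + i` for
the two generators of the `i`-th factor of rank two, `j ↦ 2 s + j` for the group algebra. -/
def idx : BlockIndex F.s (n - 2 * F.s) → Fin n
  | Sum.inl i => ⟨i, by have := F.two_mul_le; omega⟩
  | Sum.inr (Sum.inl i) => ⟨i + F.s, by have := F.two_mul_le; omega⟩
  | Sum.inr (Sum.inr j) => ⟨2 * F.s + j, by have := F.two_mul_le; omega⟩

/-- The vector space `M(α)`, with basis `e a` for `a : ∀ i, ZMod (k i)`. -/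
def Model (_α : Fin n → Kˣ) : Type u := (∀ i, ZMod (F.k i)) →₀ K

variable (α : Fin n → Kˣ)

instance : AddCommGroup (F.Model α) := inferInstanceAs (AddCommGroup ((∀ i, ZMod (F.k i)) →₀ K))

instance : Module K (F.Model α) := inferInstanceAs (Module K ((∀ i, ZMod (F.k i)) →₀ K))

/-- The right action of the quantum torus on `M(α)`, through the normal form. -/
def rep : QuantumTorus q →ₐ[K] (Module.End K (F.Model α))ᵐᵒᵖ :=
  (blockRep F.k F.c F.c_pow_k (α ∘ F.idx)).comp F.iso.symm.toAlgHom

/-- `M(α)` as a right module over the quantum torus. -/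
instance : Module (QuantumTorus q)ᵐᵒᵖ (F.Model α) :=
  Module.compHom (F.Model α) (AlgHom.opComm (F.rep α)).toRingHom

/-- `M(α)` as a right module over the quantum affine space, by restriction. -/
instance : Module (QuantumAffine q)ᵐᵒᵖ (F.Model α) :=
  Module.compHom (F.Model α) (AlgHom.op (toTorus q)).toRingHom

end NormalForm

/-- All variables act nontrivially on the right module `N`. -/
def VariablesActNontrivially (q : Matrix (Fin n) (Fin n) Kˣ) (N : Type*) [AddCommGroup N]
    [Module (QuantumAffine q)ᵐᵒᵖ N] : Prop :=
  ∀ i, ∃ v : N, op (QuantumAffine.x q i) • v ≠ 0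

/-- The given right module structure over the quantum torus extends the one over the quantum affine
space. -/
def ExtendsAction (q : Matrix (Fin n) (Fin n) Kˣ) (N : Type*) [AddCommGroup N]
    [Module (QuantumAffine q)ᵐᵒᵖ N] [Module (QuantumTorus q)ᵐᵒᵖ N] : Prop :=
  ∀ (a : QuantumAffine q) (v : N), op (toTorus q a) • v = op a • v

end NormalForms

end QuantumSpace

end

open QuantumSpace

/-! The parameter matrix behaves like an alternating form over `ℤ/m`, and the normal form comes from
symplectic elimination. Replacing each `x k` by `x k * x p ^ a k` with `a p = 0` (a `shear`) is an
invertible change of generators. Among the entries different from 1 of all matrices reachable by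
shears, take `ζ ^ h` with `h` least. Division with remainder clears its rows and columns, and
minimality then forces all other entries into the group generated by `ζ ^ h`. So a rank two factor
splits off, and induction (`nonempty_blockReduction`) gives the chain of divisors. That `h` divides
`m` needs a third generator; with only two generators left no shear changes the parameter, and the
factor `z` records the discrepancy.

On a simple module a normal generator that acts nontrivially acts bijectively (`bijective_x_smul`),
so the action extends to the torus by its universal property. Suitable powers of the generators are
central, so a simple torus module is finite over a finitely generated commutative algebra of central
operators. Nakayama and the Nullstellensatz make it finite-dimensional, with these powers acting as
scalars (`exists_scalar_of_isSimpleModule`). A joint eigenvector of the commuting products `X (i+s)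
* X i`, translated by the rescaled `X i`, then spans an image of some `M(α)` (`exists_intertwiner`).

Each `M(α)` is simple: the same products are diagonal on the basis with eigenvalues that separate
it, and the `X i` permute the basis up to scalars. A nonzero map between simple modules is an
isomorphism. -/

noncomputable section

namespace QuantumSpace

universe u

/-! ### Quantum tori and their monomial changes of generators -/

section Torus

variable {K : Type u} [Field K] {ι κ : Type} {q : Matrix ι ι Kˣ}

/-- The generator `x i` of the quantum torus as a unit. -/
def QuantumTorus.xUnit (q : Matrix ι ι Kˣ) (i : ι) : (QuantumTorus q)ˣ where
  val := QuantumTorus.x q i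
  inv := RingQuot.mkAlgHom K (TorusRel q) (FreeAlgebra.ι K (Sum.inr i))
  val_inv := by
    have h := RingQuot.mkAlgHom_rel K (TorusRel.mul_inv (q := q) i)
    rw [map_mul, map_one] at h
    exact h
  inv_val := by
    have h := RingQuot.mkAlgHom_rel K (TorusRel.inv_mul (q := q) i)
    rw [map_mul, map_one] at h
    exact h

@[simp]
lemma QuantumTorus.val_xUnit (i : ι) : (xUnit q i : QuantumTorus q) = x q i := rfl

lemma QuantumTorus.x_mul_x (i j : ι) : x q i * x q j = (q i j : K) • (x q j * x q i) := by
  have h := RingQuot.mkAlgHom_rel K (TorusRel.comm (q := q) i j)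
  rw [map_mul, map_smul, map_mul] at h
  exact h

/-- To prove a property of all elements of the quantum torus it suffices to check it on scalars,
generators and their inverses, and that it passes to sums and products. -/
lemma QuantumTorus.induction {P : QuantumTorus q → Prop}
    (hK : ∀ r : K, P (algebraMap K _ r)) (hx : ∀ i, P (x q i))
    (hx' : ∀ i, P ((xUnit q i)⁻¹ : (QuantumTorus q)ˣ))
    (hadd : ∀ a b, P a → P b → P (a + b)) (hmul : ∀ a b, P a → P b → P (a * b))
    (a : QuantumTorus q) : P a := by
  obtain ⟨y, rfl⟩ := RingQuot.mkAlgHom_surjective K (TorusRel q) a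
  induction y using FreeAlgebra.induction with
  | grade0 r => rw [AlgHom.commutes]; exact hK r
  | grade1 i =>
    rcases i with i | i
    · exact hx i
    · exact hx' i
  | mul a b ha hb => rw [map_mul]; exact hmul _ _ ha hb
  | add a b ha hb => rw [map_add]; exact hadd _ _ ha hb

lemma QuantumAffine.induction {P : QuantumAffine q → Prop}
    (hK : ∀ r : K, P (algebraMap K _ r)) (hx : ∀ i, P (x q i))
    (hadd : ∀ a b, P a → P b → P (a + b)) (hmul : ∀ a b, P a → P b → P (a * b))
    (a : QuantumAffine q) : P a := by
  obtain ⟨y, rfl⟩ := RingQuot.mkAlgHom_surjective K (AffineRel q) a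
  induction y using FreeAlgebra.induction with
  | grade0 r => rw [AlgHom.commutes]; exact hK r
  | grade1 i => exact hx i
  | mul a b ha hb => rw [map_mul]; exact hmul _ _ ha hb
  | add a b ha hb => rw [map_add]; exact hadd _ _ ha hb

lemma QuantumAffine.x_mul_x (i j : ι) : x q i * x q j = (q i j : K) • (x q j * x q i) := by
  have h := RingQuot.mkAlgHom_rel K (AffineRel.comm (q := q) i j)
  rw [map_mul, map_smul, map_mul] at h
  exact h

@[simp]
lemma toTorus_x (i : ι) : toTorus q (QuantumAffine.x q i) = QuantumTorus.x q i := by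
  simp only [toTorus, QuantumAffine.x]
  erw [RingQuot.liftAlgHom_mkAlgHom_apply]
  simp

section Lift

variable {B : Type*} [Ring B] [Algebra K B] (f : ι → Bˣ)
    (hf : ∀ i j, (f i * f j : B) = (q i j : K) • (f j * f i : B))

@[simp]
lemma QuantumTorus.lift_x (i : ι) : QuantumTorus.lift f hf (x q i) = f i := by
  simp only [QuantumTorus.lift, QuantumTorus.x]
  erw [RingQuot.liftAlgHom_mkAlgHom_apply]
  simp

omit [Algebra K B] in
lemma map_units_inv_eq {A : Type*} [Ring A] (φ ψ : A →+* B) (a : Aˣ) (h : φ a = ψ a) :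
    φ (a⁻¹ : Aˣ) = ψ (a⁻¹ : Aˣ) := by
  have h' : Units.map φ.toMonoidHom a = Units.map ψ.toMonoidHom a := Units.ext h
  have := congrArg (fun u => ((u⁻¹ : Bˣ) : B)) h'
  simpa [← map_inv] using this

lemma QuantumTorus.algHom_ext {φ ψ : QuantumTorus q →ₐ[K] B} (h : ∀ i, φ (x q i) = ψ (x q i)) :
    φ = ψ := by
  ext a
  induction a using QuantumTorus.induction with
  | hK r => simp
  | hx i => exact h i
  | hx' i => exact map_units_inv_eq (φ : QuantumTorus q →+* B) ψ _ (h i)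
  | hadd a b ha hb => simp [ha, hb]
  | hmul a b ha hb => simp [ha, hb]

end Lift

/-- Renumbering the generators of a quantum torus. -/
lemma nonempty_algEquiv_of_equiv (r : Matrix κ κ Kˣ) (q : Matrix ι ι Kˣ) (e : κ ≃ ι)
    (h : ∀ i j, r i j = q (e i) (e j)) : Nonempty (QuantumTorus r ≃ₐ[K] QuantumTorus q) := by
  let f (i : κ) : (QuantumTorus q)ˣ := QuantumTorus.xUnit q (e i)
  have hf (i j : κ) : (f i * f j : QuantumTorus q) = (r i j : K) • (f j * f i : QuantumTorus q) := by
    rw [h]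
    exact QuantumTorus.x_mul_x _ _
  let g (i : ι) : (QuantumTorus r)ˣ := QuantumTorus.xUnit r (e.symm i)
  have hg (i j : ι) : (g i * g j : QuantumTorus r) = (q i j : K) • (g j * g i : QuantumTorus r) := by
    have h' := QuantumTorus.x_mul_x (q := r) (e.symm i) (e.symm j)
    rwa [h, e.apply_symm_apply, e.apply_symm_apply] at h'
  refine ⟨AlgEquiv.ofAlgHom (QuantumTorus.lift f hf) (QuantumTorus.lift g hg) ?_ ?_⟩
  · exact QuantumTorus.algHom_ext fun i => by simp [f, g]
  · exact QuantumTorus.algHom_ext fun i => by simp [f, g]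

/-- The parameter matrix of the elements `x k * x p ^ a k`, see `QuantumTorus.shearHom`. -/
def shear {G : Type*} [CommGroup G] (q : Matrix ι ι G) (p : ι) (a : ι → ℤ) : Matrix ι ι G :=
  fun k l => q k l * q p l ^ a k * q k p ^ a l

/-- If `u v = r v u` with a scalar `r`, then `u ^ n v = r ^ n v u ^ n`. -/
lemma units_zpow_mul {B : Type*} [Ring B] [Algebra K B] {u v : Bˣ} {r : Kˣ}
    (h : u * v = Units.map (algebraMap K B).toMonoidHom r * (v * u)) (n : ℤ) :
    u ^ n * v = Units.map (algebraMap K B).toMonoidHom (r ^ n) * (v * u ^ n) := by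
  set σ := Units.map (algebraMap K B).toMonoidHom
  have hσ (r : Kˣ) (w : Bˣ) : Commute (σ r) w := Units.ext (Algebra.commutes (r : K) (w : B))
  -- Conjugation by `v⁻¹` multiplies `u` by a central scalar and commutes with integer powers, which
  -- covers negative `n` too.
  have h1 : v⁻¹ * u * v⁻¹⁻¹ = σ r * u := by
    rw [inv_inv, mul_assoc, h, ← mul_assoc, (hσ r _).symm.eq, mul_assoc, inv_mul_cancel_left]
  have h2 : v⁻¹ * u ^ n * v⁻¹⁻¹ = σ (r ^ n) * u ^ n := by
    rw [← conj_zpow, h1, (hσ r u).mul_zpow, map_zpow]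
  rw [← mul_assoc, ← (hσ _ v).symm.eq, mul_assoc, ← h2]
  simp only [inv_inv, mul_assoc, mul_inv_cancel_left]

lemma units_mul_eq_iff {B : Type*} [Ring B] [Algebra K B] {u v : Bˣ} {r : Kˣ} :
    (u * v : B) = (r : K) • (v * u : B) ↔
      u * v = Units.map (algebraMap K B).toMonoidHom r * (v * u) := by
  rw [Units.ext_iff, Algebra.smul_def]
  rfl

/-- Both products are scalar multiples of the same monomial `f j * f i * f p ^ (a i + a j)`, and the
quotient of the two scalars is the sheared parameter. -/
lemma shear_comm {B : Type*} [Ring B] [Algebra K B] {q : Matrix ι ι Kˣ} (hq : MultAntisymm q)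
    (f : ι → Bˣ) (hf : ∀ i j, (f i * f j : B) = (q i j : K) • (f j * f i : B)) (p : ι) (a : ι → ℤ)
    (i j : ι) :
    (((f i * f p ^ a i : Bˣ) : B) * ((f j * f p ^ a j : Bˣ) : B)) =
      ((shear q p a i j : Kˣ) : K) • (((f j * f p ^ a j : Bˣ) : B) * ((f i * f p ^ a i : Bˣ) : B)) := by
  have hq' : q i p = (q p i)⁻¹ := by
    rcases eq_or_ne p i with rfl | h
    · simp [hq.1]
    · exact hq.2 _ _ h
  rw [units_mul_eq_iff]
  have hf' (i j : ι) := units_mul_eq_iff.1 (hf i j)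
  set σ := Units.map (algebraMap K B).toMonoidHom
  have hσ (r : Kˣ) (w : Bˣ) : w * σ r = σ r * w :=
    (Units.ext (Algebra.commutes (r : K) (w : B))).symm
  have hσ' (r : Kˣ) (w w' : Bˣ) : w * (σ r * w') = σ r * (w * w') := by
    rw [← mul_assoc, hσ, mul_assoc]
  have h1 := units_zpow_mul (hf' p j) (a i)
  have h2 := units_zpow_mul (hf' p i) (a j)
  have e1 : f i * f p ^ a i * (f j * f p ^ a j) =
      σ (q p j ^ a i * q i j) * (f j * (f i * (f p ^ (a i + a j)))) := by
    calc _ = f i * (f p ^ a i * f j) * f p ^ a j := by group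
      _ = σ (q p j ^ a i) * (f i * f j * f p ^ (a i + a j)) := by
        rw [h1, hσ']; simp only [mul_assoc, zpow_add]
      _ = _ := by rw [hf' i j, map_mul]; simp only [mul_assoc]
  have e2 : f j * f p ^ a j * (f i * f p ^ a i) =
      σ (q p i ^ a j) * (f j * (f i * (f p ^ (a i + a j)))) := by
    calc _ = f j * (f p ^ a j * f i) * f p ^ a i := by group
      _ = _ := by rw [h2, hσ']; simp only [mul_assoc, add_comm (a i), zpow_add]
  rw [e1, e2, ← mul_assoc (σ _) (σ _), ← map_mul, shear, hq']
  congr 2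
  rw [inv_zpow, mul_assoc (q i j * _), inv_mul_cancel, mul_one, mul_comm]

lemma MultAntisymm.inv_eq {q : Matrix ι ι Kˣ} (hq : MultAntisymm q) (i j : ι) :
    q j i = (q i j)⁻¹ := by
  rcases eq_or_ne i j with rfl | h
  · simp [hq.1]
  · exact hq.2 _ _ h

lemma MultAntisymm.shear {q : Matrix ι ι Kˣ} (hq : MultAntisymm q) (p : ι) (a : ι → ℤ) :
    MultAntisymm (shear q p a) := by
  constructor
  · intro i
    rw [QuantumSpace.shear, hq.1, one_mul, hq.inv_eq p i, ← mul_zpow, mul_inv_cancel, one_zpow]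
  · intro i j _
    simp only [QuantumSpace.shear, mul_inv, ← inv_zpow, ← hq.inv_eq]
    rw [mul_assoc, mul_assoc, mul_comm (q j p ^ _)]

/-- Since `a p = 0` and `q p p = 1`, the row and column of `p` are not changed by the shear, so the
opposite exponents undo it. -/
lemma shear_neg_shear {q : Matrix ι ι Kˣ} (hq : MultAntisymm q) (p : ι) (a : ι → ℤ) (ha : a p = 0) :
    shear (shear q p a) p (-a) = q := by
  funext k l
  change q k l * q p l ^ a k * q k p ^ a l * (q p l * q p l ^ a p * q p p ^ a l) ^ (-a k) *
    (q k p * q p p ^ a k * q k p ^ a p) ^ (-a l) = q k l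
  rw [ha, hq.1]
  simp only [zpow_zero, mul_one, one_zpow, zpow_neg]
  rw [mul_right_comm _ _ (q p l ^ a k)⁻¹]
  simp only [mul_inv_cancel_right]

/-- Replacing the generators `x k` of a quantum torus by `x k * x p ^ a k`, for a fixed `p` with
`a p = 0`. -/
lemma nonempty_algEquiv_shear {q : Matrix ι ι Kˣ} (hq : MultAntisymm q) (p : ι) (a : ι → ℤ)
    (ha : a p = 0) : Nonempty (QuantumTorus (shear q p a) ≃ₐ[K] QuantumTorus q) := by
  -- Stated with an equation for `r`, so that the inverse map is the same construction for `-a`,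
  -- without a transport along `shear_neg_shear`.
  have key (q r : Matrix ι ι Kˣ) (b : ι → ℤ) (hr : r = shear q p b) (hq : MultAntisymm q)
      (hb : b p = 0) : ∃ φ : QuantumTorus r →ₐ[K] QuantumTorus q, ∀ i, Units.map (MonoidHomClass.toMonoidHom φ)

        (QuantumTorus.xUnit r i) = QuantumTorus.xUnit q i * QuantumTorus.xUnit q p ^ b i := by
    subst hr
    exact ⟨QuantumTorus.lift _ (shear_comm hq (QuantumTorus.xUnit q) QuantumTorus.x_mul_x p b), fun i => by
      ext; exact QuantumTorus.lift_x _ _ i⟩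
  obtain ⟨φ, hφ⟩ := key q _ a rfl hq ha
  obtain ⟨ψ, hψ⟩ := key (shear q p a) q (-a) (shear_neg_shear hq p a ha).symm (hq.shear p a)
    (by simp [ha])
  have hφp := hφ p
  have hψp := hψ p
  simp only [Pi.neg_apply, ha, neg_zero, zpow_zero, mul_one] at hφp hψp
  refine ⟨AlgEquiv.ofAlgHom φ ψ ?_ ?_⟩
  · refine QuantumTorus.algHom_ext fun i => congrArg Units.val (?_ :
      Units.map (MonoidHomClass.toMonoidHom φ) (Units.map (MonoidHomClass.toMonoidHom ψ) (QuantumTorus.xUnit q i)) =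
        QuantumTorus.xUnit q i)
    rw [hψ, map_mul, map_zpow, hφ, hφp]
    simp
  · refine QuantumTorus.algHom_ext fun i => congrArg Units.val (?_ :
      Units.map (MonoidHomClass.toMonoidHom ψ) (Units.map (MonoidHomClass.toMonoidHom φ) (QuantumTorus.xUnit (shear q p a) i)) =
        QuantumTorus.xUnit (shear q p a) i)
    rw [hφ, map_mul, map_zpow, hψ, hψp]
    simp

end Torus

/-! ### Elimination by shears with a minimal exponent -/

section Reduction

variable {K : Type u} [Field K] {ι : Type}

/-- `q'` is obtained from `q` by a sequence of shears. -/
def Reach : Matrix ι ι Kˣ → Matrix ι ι Kˣ → Prop :=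
  Relation.ReflTransGen fun q q' => ∃ p a, a p = 0 ∧ q' = shear q p a

lemma Reach.shear {q q' : Matrix ι ι Kˣ} (h : Reach q q') {p : ι} {a : ι → ℤ} (ha : a p = 0) :
    Reach q (shear q' p a) :=
  Relation.ReflTransGen.tail h ⟨p, a, ha, rfl⟩

lemma Reach.trans {q q' q'' : Matrix ι ι Kˣ} (h : Reach q q') (h' : Reach q' q'') : Reach q q'' :=
  Relation.ReflTransGen.trans h h'

lemma Reach.multAntisymm {q q' : Matrix ι ι Kˣ} (h : Reach q q') (hq : MultAntisymm q) :
    MultAntisymm q' := by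
  induction h with
  | refl => exact hq
  | tail _ h ih =>
    obtain ⟨p, a, -, rfl⟩ := h
    exact ih.shear p a

lemma shear_mem {q : Matrix ι ι Kˣ} {H : Subgroup Kˣ} (h : ∀ k l, q k l ∈ H) (p : ι) (a : ι → ℤ)
    (k l : ι) : shear q p a k l ∈ H :=
  mul_mem (mul_mem (h k l) (zpow_mem (h p l) _)) (zpow_mem (h k p) _)

lemma Reach.mem {q q' : Matrix ι ι Kˣ} (h : Reach q q') {H : Subgroup Kˣ}
    (hH : ∀ k l, q k l ∈ H) (k l : ι) : q' k l ∈ H := by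
  induction h generalizing k l with
  | refl => exact hH k l
  | tail _ h ih =>
    obtain ⟨p, a, -, rfl⟩ := h
    exact shear_mem ih p a k l

/-- Shears are reversible, so the subgroup generated by the entries is an invariant. This is what
later forces the first divisor to be 1. -/
lemma Reach.mem_of_mem {q q' : Matrix ι ι Kˣ} (h : Reach q q') (hq : MultAntisymm q)
    {H : Subgroup Kˣ} (hH : ∀ k l, q' k l ∈ H) (k l : ι) : q k l ∈ H := by
  induction h with
  | refl => exact hH k l
  | tail h' h ih =>
    obtain ⟨p, a, ha, rfl⟩ := h
    refine ih fun k l => ?_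
    rw [← shear_neg_shear (Reach.multAntisymm h' hq) p a ha]
    exact shear_mem hH _ _ _ _

lemma Reach.nonempty_algEquiv {q q' : Matrix ι ι Kˣ} (h : Reach q q') (hq : MultAntisymm q) :
    Nonempty (QuantumTorus q' ≃ₐ[K] QuantumTorus q) := by
  induction h with
  | refl => exact ⟨AlgEquiv.refl⟩
  | tail h' h ih =>
    obtain ⟨p, a, ha, rfl⟩ := h
    obtain ⟨f⟩ := ih
    obtain ⟨g⟩ := nonempty_algEquiv_shear (Reach.multAntisymm h' hq) p a ha
    exact ⟨g.trans f⟩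

/-- Shears of a diagonal block of `q` extend to shears of `q`, if the remaining entries in the rows
and columns of this block are trivial. -/
lemma Reach.extend {q : Matrix ι ι Kˣ} {P : ι → Prop}
    (hP : ∀ k l, P k → ¬ P l → q k l = 1 ∧ q l k = 1) {r' : Matrix {k // P k} {k // P k} Kˣ}
    (h : Reach (q.submatrix (↑) (↑)) r') :
    ∃ q', Reach q q' ∧ (∀ k l : {k // P k}, q' k l = r' k l) ∧
      (∀ k l, P k → ¬ P l → q' k l = 1 ∧ q' l k = 1) ∧
      ∀ k l, ¬ P k → ¬ P l → q' k l = q k l := by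
  classical
  induction h with
  | refl => exact ⟨q, .refl, fun _ _ => rfl, hP, fun _ _ _ _ => rfl⟩
  | tail _ h ih =>
    obtain ⟨p, a, ha, rfl⟩ := h
    obtain ⟨q', h, h1, h2, h3⟩ := ih
    let b (k : ι) : ℤ := if hk : P k then a ⟨k, hk⟩ else 0
    have hb (k : {k // P k}) : b k = a k := dif_pos k.2
    have hb' (k : ι) (hk : ¬ P k) : b k = 0 := dif_neg hk
    refine ⟨QuantumSpace.shear q' p b, h.shear ((hb p).trans ha), fun k l => ?_,
      fun k l hk hl => ?_, fun k l hk hl => ?_⟩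
    · simp only [QuantumSpace.shear, h1, hb]
    · simp [QuantumSpace.shear, h2 k l hk hl, h2 p l p.2 hl, hb' l hl]
    · simp [QuantumSpace.shear, h3 k l hk hl, hb' l hl, hb' k hk]

/-- The data of a normal form, obtained by shears from `q`. -/
structure BlockReduction (ζ : Kˣ) (d : ℕ) (q : Matrix ι ι Kˣ) where
  s : ℕ
  t : ℕ
  h : Fin s → ℕ
  z : ℕ
  e : BlockIndex s t ≃ ι
  q' : Matrix ι ι Kˣ
  reach : Reach q q'
  q'_eq : ∀ x y, q' (e x) (e y) = blockMatrix (fun i => ζ ^ exponent h z i) x y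
  h_dvd_order : ∀ i, h i ∣ orderOf ζ
  h_ne_zero : ∀ i, ¬ orderOf ζ ∣ h i
  h_dvd : ∀ i j, i ≤ j → h i ∣ h j
  dvd_h : ∀ i, d ∣ h i
  z_pos : 0 < z
  z_eq_one : 0 < t → z = 1
  z_order : ∀ i : Fin s, i.val + 1 = s → orderOf (ζ ^ (z * h i)) = orderOf (ζ ^ h i)

lemma dvd_of_pow_mem_zpowers {G : Type*} [Group G] {ζ : G} {d b : ℕ} (hd : d ∣ orderOf ζ)
    (h : ζ ^ b ∈ Subgroup.zpowers (ζ ^ d)) : d ∣ b := by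
  obtain ⟨z, hz⟩ := h
  have h1 : ζ ^ (d * z - b : ℤ) = 1 := by
    rw [zpow_sub, zpow_mul, zpow_natCast, zpow_natCast, mul_inv_eq_one]
    exact hz
  rw [← orderOf_dvd_iff_zpow_eq_one] at h1
  have h2 := (Int.natCast_dvd_natCast.2 hd).trans h1
  rw [dvd_sub_right (dvd_mul_right _ _)] at h2
  exact_mod_cast h2

/-- No matrix reachable from `q` has a nontrivial entry `ζ ^ b` with `0 ≤ b < h`. -/
def MinimalExponent (ζ : Kˣ) (q : Matrix ι ι Kˣ) (h : ℕ) : Prop :=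
  ∀ q', Reach q q' → ∀ k l (b : ℤ), 0 ≤ b → b < h → q' k l = ζ ^ b → q' k l = 1

/-- The minimum ranges over all reachable matrices at once, so any further shear may be tested
against it. -/
lemma exists_minimalExponent {ζ : Kˣ} (hm : 0 < orderOf ζ) {q : Matrix ι ι Kˣ}
    (hq : MultAntisymm q) (hz : ∀ k l, q k l ∈ Subgroup.zpowers ζ) {k l : ι} (hkl : q k l ≠ 1) :
    ∃ h q' i j, Reach q q' ∧ i ≠ j ∧ q' i j = ζ ^ h ∧ ζ ^ h ≠ 1 ∧ MinimalExponent ζ q h := by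
  classical
  have aux : ∃ h : ℕ, ∃ q' i j, Reach q q' ∧ q' i j = ζ ^ h ∧ ζ ^ h ≠ 1 := by
    obtain ⟨z, hz⟩ := hz k l
    have hz' : ζ ^ (z % orderOf ζ) = q k l := (zpow_mod_orderOf ζ z).trans hz
    lift z % orderOf ζ to ℕ using Int.emod_nonneg _ (by omega) with b
    rw [zpow_natCast] at hz'
    exact ⟨b, q, k, l, .refl, hz'.symm, hz' ▸ hkl⟩
  obtain ⟨q', i, j, h1, h2, h3⟩ := Nat.find_spec aux
  refine ⟨Nat.find aux, q', i, j, h1, ?_, h2, h3, fun r hr k l b hb hb' hkl => ?_⟩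
  · rintro rfl
    rw [(h1.multAntisymm hq).1] at h2
    exact h3 h2.symm
  · lift b to ℕ using hb
    by_contra hne
    rw [zpow_natCast] at hkl
    exact Nat.find_min aux (by exact_mod_cast hb') ⟨r, k, l, hr, hkl, hkl ▸ hne⟩

lemma shear_single_apply [DecidableEq ι] (q : Matrix ι ι Kˣ) {p k l : ι} (a : ℤ) (hl : l ≠ k) :
    shear q p (Pi.single k a) k l = q k l * q p l ^ a := by
  simp [shear, hl]

/-- Division with remainder: a shear along `p` replaces the exponent `b` of the entry `(k, l)` by `b
% e`, which lies in `[0, h)`, so minimality makes the new entry trivial. Negative `e` is allowed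
because the transposed pivot has exponent `-h`. -/
lemma MinimalExponent.exists_zpow_eq_one {ζ : Kˣ} {q q' : Matrix ι ι Kˣ} {h : ℕ}
    (hmin : MinimalExponent ζ q h) (hz : ∀ k l, q k l ∈ Subgroup.zpowers ζ) (hr : Reach q q')
    {p k l : ι} {e : ℤ} (he : e.natAbs = h) (h0 : e ≠ 0) (hpl : q' p l = ζ ^ e) (hk : k ≠ p)
    (hl : l ≠ k) : ∃ a : ℤ, q' k l * q' p l ^ a = 1 := by
  classical
  obtain ⟨b, hb⟩ := hr.mem hz k l
  refine ⟨-(b / e), ?_⟩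
  rw [← shear_single_apply q' _ hl]
  refine hmin _ (hr.shear (by simp [hk.symm])) _ _ (b % e) (Int.emod_nonneg _ h0) ?_ ?_
  · rw [← he]
    have := Int.emod_lt_abs b h0
    rwa [Int.abs_eq_natAbs] at this
  · rw [shear_single_apply q' _ hl, ← hb, hpl, ← zpow_mul, Int.emod_def]
    change ζ ^ b * _ = _
    rw [← zpow_add]
    congr 1
    ring

/-- By Bézout, once the entry `(k, j)` is cleared a further multiple of row `i` turns it into `ζ ^
gcd(h, m)`. If the gcd were smaller than `h`, minimality would make this 1, hence also `ζ ^ h`. The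
third index `k` provides the room for this. -/
lemma MinimalExponent.dvd_orderOf {ζ : Kˣ} {q q' : Matrix ι ι Kˣ} {h : ℕ}
    (hmin : MinimalExponent ζ q h) (hz : ∀ k l, q k l ∈ Subgroup.zpowers ζ) (hr : Reach q q')
    {i j k : ι} (hij : q' i j = ζ ^ h) (hne : ζ ^ h ≠ 1) (hki : k ≠ i) (hkj : k ≠ j) :
    h ∣ orderOf ζ := by
  classical
  have h0 : h ≠ 0 := by
    rintro rfl
    exact hne (pow_zero ζ)
  obtain ⟨a, ha⟩ := hmin.exists_zpow_eq_one hz hr (p := i) (k := k) (l := j) (e := h) (by simp)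
    (by simpa) (by simpa) hki hkj.symm
  by_contra hdvd
  have hlt : Nat.gcd h (orderOf ζ) < h :=
    lt_of_le_of_ne (Nat.gcd_le_left _ (Nat.pos_of_ne_zero h0)) fun h' =>
      hdvd (h' ▸ Nat.gcd_dvd_right _ _)
  have key : shear q' i (Pi.single k (a + Nat.gcdA h (orderOf ζ))) k j =
      ζ ^ (Nat.gcd h (orderOf ζ) : ℤ) := by
    rw [shear_single_apply q' _ hkj.symm, zpow_add, ← mul_assoc, ha, one_mul, hij,
      Nat.gcd_eq_gcd_ab, zpow_add, zpow_mul, zpow_mul]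
    simp [pow_orderOf_eq_one]
  have h1 := hmin _ (hr.shear (by simp [hki.symm])) _ _ _ (by positivity) (by exact_mod_cast hlt) key
  rw [key, zpow_natCast, ← orderOf_dvd_iff_pow_eq_one] at h1
  exact hne (orderOf_dvd_iff_pow_eq_one.1 (h1.trans (Nat.gcd_dvd_left _ _)))

/-- Clearing the rows and columns of an entry `ζ ^ h` with minimal `h`. -/
lemma MinimalExponent.exists_reach_decoupled {ζ : Kˣ} {q q' : Matrix ι ι Kˣ} {h : ℕ}
    (hq : MultAntisymm q)
    (hmin : MinimalExponent ζ q h) (hz : ∀ k l, q k l ∈ Subgroup.zpowers ζ) (hr : Reach q q')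
    {i j : ι} (hne : i ≠ j) (hij : q' i j = ζ ^ h) (hne' : ζ ^ h ≠ 1) :
    ∃ r, Reach q r ∧ r i j = ζ ^ h ∧ ∀ k, k ≠ i → k ≠ j →
      r k i = 1 ∧ r k j = 1 ∧ ∀ l, l ≠ i → l ≠ j → r k l ∈ Subgroup.zpowers (ζ ^ h) := by
  classical
  have h0 : h ≠ 0 := by
    rintro rfl
    exact hne' (pow_zero ζ)
  -- The pivot `(i, j)` clears column `j`.
  have h1 (k : ι) : ∃ a : ℤ, (k = i ∨ k = j → a = 0) ∧
      (k ≠ i → k ≠ j → q' k j * q' i j ^ a = 1) := by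
    by_cases hk : k = i ∨ k = j
    · exact ⟨0, fun _ => rfl, fun h1 h2 => absurd hk (by tauto)⟩
    · obtain ⟨a, ha⟩ := hmin.exists_zpow_eq_one hz hr (p := i) (k := k) (l := j) (e := h) (by simp)
        (by simpa) (by simpa) (by tauto) (by tauto)
      exact ⟨a, fun h => absurd h hk, fun _ _ => ha⟩
  choose a ha ha' using h1
  have hr2 := hr.shear (ha i (Or.inl rfl))
  have e1 : shear q' i a i j = ζ ^ h := by simp [shear, ha i, ha j, hij]
  have e2 (k) (hki : k ≠ i) (hkj : k ≠ j) : shear q' i a k j = 1 := by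
    simpa [shear, ha j] using ha' k hki hkj
  generalize shear q' i a = q2 at hr2 e1 e2
  have hq2 := hr2.multAntisymm hq
  -- The transposed pivot `(j, i)` clears column `i`; column `j` stays cleared because `q2 k j` and
  -- `q2 j j` are 1.
  have h2 (k : ι) : ∃ a : ℤ, (k = i ∨ k = j → a = 0) ∧
      (k ≠ i → k ≠ j → q2 k i * q2 j i ^ a = 1) := by
    by_cases hk : k = i ∨ k = j
    · exact ⟨0, fun _ => rfl, fun h1 h2 => absurd hk (by tauto)⟩
    · obtain ⟨a, ha⟩ := hmin.exists_zpow_eq_one hz hr2 (p := j) (k := k) (l := i) (e := -h)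
        (by simp) (by simpa) (by rw [hq2.inv_eq i j, e1]; simp) (by tauto) (by tauto)
      exact ⟨a, fun h => absurd h hk, fun _ _ => ha⟩
  choose b hb hb' using h2
  have hr3 := hr2.shear (hb j (Or.inr rfl))
  have e3 : shear q2 j b i j = ζ ^ h := by simp [shear, hb i, hb j, e1]
  have e4 (k) (hki : k ≠ i) (hkj : k ≠ j) : shear q2 j b k j = 1 := by
    simp [shear, hb j, e2 k hki hkj, hq2.1]
  have e5 (k) (hki : k ≠ i) (hkj : k ≠ j) : shear q2 j b k i = 1 := by
    simpa [shear, hb i] using hb' k hki hkj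
  generalize shear q2 j b = r at hr3 e3 e4 e5
  have hr' := hr3.multAntisymm hq
  refine ⟨r, hr3, e3, fun k hki hkj => ⟨e5 k hki hkj, e4 k hki hkj, fun l hli hlj => ?_⟩⟩
  -- Adding row `k` to row `i` copies `r k l` into the row of the pivot and leaves the pivot
  -- unchanged. Clearing it there exhibits `r k l` as a power of `ζ ^ h`.
  have hr4 := hr3.shear (p := k) (a := Pi.single i 1) (by simp [hki])
  have hq4 := hr4.multAntisymm hq
  have f1 : shear r k (Pi.single i 1) i l = r k l := by
    rw [shear_single_apply _ _ hli, hr'.inv_eq l i, e5 l hli hlj]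
    simp
  have f2 : shear r k (Pi.single i 1) i j = ζ ^ h := by
    rw [shear_single_apply _ _ hne.symm, e3, e4 k hki hkj]
    simp
  obtain ⟨c, hc⟩ := hmin.exists_zpow_eq_one hz hr4 (p := j) (k := l) (l := i) (e := -h)
    (by simp) (by simpa) (by rw [hq4.inv_eq i j, f2]; simp) hlj hli.symm
  rw [hq4.inv_eq i l, f1, hq4.inv_eq i j, f2, inv_mul_eq_one] at hc
  rw [hc]
  exact zpow_mem (inv_mem (Subgroup.mem_zpowers _)) _

end Reduction

/-! ### Existence of the normal form -/

section BlockReduction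

variable {K : Type u} [Field K] {ι : Type}

/-- The reduction of a matrix with trivial entries. -/
lemma nonempty_blockReduction_of_eq_one [Fintype ι] {ζ : Kˣ} {d : ℕ} {q : Matrix ι ι Kˣ}
    (hq : ∀ k l, q k l = 1) : Nonempty (BlockReduction ζ d q) := by
  let e : BlockIndex 0 (Fintype.card ι) ≃ ι :=
    (Equiv.emptySum _ _).trans ((Equiv.emptySum _ _).trans (Fintype.equivFin ι).symm)
  exact ⟨{
    s := 0
    t := Fintype.card ι
    h := Fin.elim0
    z := 1
    e := e
    q' := q
    reach := .refl
    q'_eq := fun x y => by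
      rcases x with x | x | x
      · exact x.elim0
      · exact x.elim0
      rcases y with y | y | y
      · exact y.elim0
      · exact y.elim0
      exact hq _ _
    h_dvd_order := fun i => i.elim0
    h_ne_zero := fun i => i.elim0
    h_dvd := fun i => i.elim0
    dvd_h := fun i => i.elim0
    z_pos := one_pos
    z_eq_one := fun _ => rfl
    z_order := fun i => i.elim0 }⟩

/-- The reduction of a nontrivial matrix of size two. -/
lemma nonempty_blockReduction_of_two {ζ : Kˣ} {d : ℕ} {q : Matrix ι ι Kˣ}
    (hm : 0 < orderOf ζ) (hd : d ∣ orderOf ζ)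
    (hq : MultAntisymm q) (hz : ∀ k l, q k l ∈ Subgroup.zpowers (ζ ^ d)) {i j : ι} (hij : i ≠ j)
    (htwo : ∀ k, k = i ∨ k = j) (hne : q i j ≠ 1) : Nonempty (BlockReduction ζ d q) := by
  obtain ⟨h, hh, hh0⟩ : ∃ h : ℕ, q i j = ζ ^ h ∧ ¬ orderOf ζ ∣ h := by
    obtain ⟨z, hz⟩ := hz i j
    have hz' : ζ ^ ((d * z) % orderOf ζ) = q i j := by
      rw [zpow_mod_orderOf, zpow_mul, zpow_natCast]
      exact hz
    lift (d * z) % orderOf ζ to ℕ using Int.emod_nonneg _ (by omega) with b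
    rw [zpow_natCast] at hz'
    exact ⟨b, hz'.symm, fun h => hne (hz' ▸ orderOf_dvd_iff_pow_eq_one.1 h)⟩
  have hdh : d ∣ h := dvd_of_pow_mem_zpowers hd (hh ▸ hz i j)
  have hpos : 0 < h := Nat.pos_of_ne_zero fun h' => hh0 (h' ▸ dvd_zero _)
  -- The exponent `h` need not divide the order. It is written as `z * g` with `g` the gcd, so that
  -- `ζ ^ h` and `ζ ^ g` have the same order.
  set g := Nat.gcd h (orderOf ζ) with hg
  have hgh : h / g * g = h := Nat.div_mul_cancel (Nat.gcd_dvd_left _ _)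
  let f : BlockIndex 1 0 → ι := Sum.elim (fun _ => i) (Sum.elim (fun _ => j) Fin.elim0)
  have hf : Function.Bijective f := by
    constructor
    · rintro (x | x | x) (y | y | y) hxy
      · simp [Subsingleton.elim x y]
      · exact absurd hxy hij
      · exact y.elim0
      · exact absurd hxy.symm hij
      · simp [Subsingleton.elim x y]
      · exact y.elim0
      all_goals exact x.elim0
    · intro k
      rcases htwo k with rfl | rfl
      · exact ⟨Sum.inl 0, rfl⟩
      · exact ⟨Sum.inr (Sum.inl 0), rfl⟩
  exact ⟨{
    s := 1
    t := 0
    h := fun _ => g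
    z := h / g
    e := Equiv.ofBijective f hf
    q' := q
    reach := .refl
    q'_eq := fun x y => by
      have hc (x : Fin 1) : ζ ^ exponent (fun _ => g) (h / g) x = q i j := by
        rw [hh, exponent, if_pos (by omega), hgh]
      rcases x with x | x | x
      · rcases y with y | y | y
        · exact hq.1 _
        · simp only [blockMatrix, Subsingleton.elim x y, if_true, hc]
          rfl
        · exact y.elim0
      · rcases y with y | y | y
        · simp only [blockMatrix, Subsingleton.elim x y, if_true, hc]
          exact hq.inv_eq _ _
        · exact hq.1 _
        · exact y.elim0
      · exact x.elim0
    h_dvd_order := fun _ => Nat.gcd_dvd_right _ _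
    h_ne_zero := fun _ h' => hh0 (h'.trans (Nat.gcd_dvd_left _ _))
    h_dvd := fun _ _ _ => dvd_rfl
    dvd_h := fun _ => Nat.dvd_gcd hdh hd
    z_pos := Nat.div_pos (Nat.gcd_le_left _ hpos) (Nat.gcd_pos_of_pos_left _ hpos)
    z_eq_one := fun h => absurd h (lt_irrefl _)
    z_order := fun i _ => by
      rw [hgh, orderOf_pow' ζ hpos.ne', orderOf_pow' ζ (Nat.gcd_pos_of_pos_left _ hpos).ne',
        Nat.gcd_eq_right (Nat.gcd_dvd_right h (orderOf ζ)), Nat.gcd_comm] }⟩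

/-- Splitting off a block of rank two. -/
lemma BlockReduction.nonempty_of_decoupled {ζ : Kˣ} {d h : ℕ} {q r : Matrix ι ι Kˣ}
    (hq : MultAntisymm q) (hr : Reach q r) {i j : ι} (hij : i ≠ j) (hrij : r i j = ζ ^ h)
    (hne : ζ ^ h ≠ 1) (hm : h ∣ orderOf ζ) (hd : d ∣ h)
    (h1 : ∀ k, k ≠ i → k ≠ j → r k i = 1 ∧ r k j = 1)
    (R : BlockReduction ζ h (r.submatrix (Subtype.val : {k // k ≠ i ∧ k ≠ j} → ι) Subtype.val))
    {k : ι} (hki : k ≠ i) (hkj : k ≠ j) :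
    Nonempty (BlockReduction ζ d q) := by
  have hr0 := hr.multAntisymm hq
  obtain ⟨q', hq', e1, e2, e3⟩ := Reach.extend (P := fun k => k ≠ i ∧ k ≠ j) (r' := R.q') (q := r)
    (fun k l hk hl => by
      obtain ⟨h2, h3⟩ := h1 k hk.1 hk.2
      have hl : l = i ∨ l = j := by tauto
      rcases hl with rfl | rfl
      · simp [h2, hr0.inv_eq k l]
      · simp [h3, hr0.inv_eq k l]) R.reach
  have hq0 := (hr.trans hq').multAntisymm hq
  have e4 : q' i j = ζ ^ h := by rw [e3 _ _ (by simp) (by simp), hrij]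
  have e5 : q' j i = (ζ ^ h)⁻¹ := by rw [hq0.inv_eq i j, e4]
  have e6 (k : {k // k ≠ i ∧ k ≠ j}) := e2 k i k.2 (by simp)
  have e7 (k : {k // k ≠ i ∧ k ≠ j}) := e2 k j k.2 (by simp)
  have e8 (x y) : q' (R.e x) (R.e y) = blockMatrix (fun i => ζ ^ exponent R.h R.z i) x y := by
    rw [e1, R.q'_eq]
  let f : BlockIndex (R.s + 1) R.t → ι :=
    Sum.elim (Fin.cases i fun x => R.e (Sum.inl x))
      (Sum.elim (Fin.cases j fun x => R.e (Sum.inr (Sum.inl x))) fun x => R.e (Sum.inr (Sum.inr x)))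
  have hf : Function.Bijective f := by
    have hi (x) : (R.e x : ι) ≠ i := (R.e x).2.1
    have hj (x) : (R.e x : ι) ≠ j := (R.e x).2.2
    constructor
    · rintro (x | x | x) (y | y | y) <;> try cases x using Fin.cases
      all_goals try cases y using Fin.cases
      all_goals simp [f, hi, hj, (hi _).symm, (hj _).symm, hij, hij.symm, Subtype.val_inj]
    · intro k
      by_cases hk : k ≠ i ∧ k ≠ j
      · rcases hx : R.e.symm ⟨k, hk⟩ with x | x | x
        · exact ⟨Sum.inl x.succ, by simp [f, ← hx]⟩
        · exact ⟨Sum.inr (Sum.inl x.succ), by simp [f, ← hx]⟩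
        · exact ⟨Sum.inr (Sum.inr x), by simp [f, ← hx]⟩
      · have hk : k = i ∨ k = j := by tauto
        rcases hk with rfl | rfl
        · exact ⟨Sum.inl 0, rfl⟩
        · exact ⟨Sum.inr (Sum.inl 0), rfl⟩
  -- If the remaining part has no rank two factor, the new factor is also the last one and would be
  -- given the factor `z`. The remaining index `k` then belongs to the group algebra, so `z = 1`.
  have hz : R.s = 0 → R.z = 1 := fun hs => R.z_eq_one <| by
    rcases hx : R.e.symm ⟨k, hki, hkj⟩ with x | x | x
    · exact absurd x.2 (by omega)
    · exact absurd x.2 (by omega)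
    · exact x.pos
  have hc0 : exponent (Fin.cons h R.h : Fin (R.s + 1) → ℕ) R.z 0 = h := by
    simp only [exponent, Fin.val_zero, Fin.cons_zero]
    split_ifs with hs
    · rw [hz (by omega), one_mul]
    · rfl
  have hc1 (x : Fin R.s) : exponent (Fin.cons h R.h : Fin (R.s + 1) → ℕ) R.z x.succ =
      exponent R.h R.z x := by
    simp [exponent]
  exact ⟨{
    s := R.s + 1
    t := R.t
    h := Fin.cons h R.h
    z := R.z
    e := Equiv.ofBijective f hf
    q' := q'
    reach := hr.trans hq'
    q'_eq := by
      rintro (x | x | x) (y | y | y) <;> try cases x using Fin.cases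
      all_goals try cases y using Fin.cases
      all_goals simp [f, blockMatrix, hc0, hc1, e4, e5, e6, e7, e8, hq0.1, Fin.succ_ne_zero,
        (Fin.succ_ne_zero _).symm]
    h_dvd_order := Fin.cases hm R.h_dvd_order
    h_ne_zero := Fin.cases (fun h' => hne (orderOf_dvd_iff_pow_eq_one.1 h')) R.h_ne_zero
    h_dvd := fun x y hxy => by
      cases x using Fin.cases with
      | zero => cases y using Fin.cases with
        | zero => simp
        | succ y => simpa using R.dvd_h y
      | succ x => cases y using Fin.cases with
        | zero => simp at hxy
        | succ y => simpa using R.h_dvd x y (by simpa using hxy)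
    dvd_h := Fin.cases hd fun x => hd.trans (R.dvd_h x)
    z_pos := R.z_pos
    z_eq_one := R.z_eq_one
    z_order := by
      intro x hx
      cases x using Fin.cases with
      | zero => simp [hz (by simpa using hx.symm)]
      | succ x => simpa using R.z_order x (by simpa using hx) }⟩

/-- Induction on the number of generators. The parameter `d` carries the previous divisor: all
entries are powers of `ζ ^ d`, so the next divisor is a multiple of `d`. -/
theorem nonempty_blockReduction [Fintype ι] {ζ : Kˣ} (hm : 0 < orderOf ζ) {d : ℕ}
    (hd : d ∣ orderOf ζ) {q : Matrix ι ι Kˣ} (hq : MultAntisymm q)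
    (hz : ∀ k l, q k l ∈ Subgroup.zpowers (ζ ^ d)) : Nonempty (BlockReduction ζ d q) := by
  classical
  induction hN : Fintype.card ι using Nat.strong_induction_on generalizing ι d with
  | _ N ih =>
  by_cases h1 : ∀ k l, q k l = 1
  · exact nonempty_blockReduction_of_eq_one h1
  push Not at h1
  obtain ⟨i₀, j₀, h1⟩ := h1
  have hz' (k l : ι) : q k l ∈ Subgroup.zpowers ζ :=
    (Subgroup.zpowers_le.2 (Subgroup.npow_mem_zpowers ζ d)) (hz k l)
  by_cases h2 : ∀ k, k = i₀ ∨ k = j₀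
  · refine nonempty_blockReduction_of_two hm hd hq hz (i := i₀) (j := j₀) ?_ h2 h1
    rintro rfl
    exact h1 (hq.1 _)
  obtain ⟨h, q', i, j, hr, hij, hq'ij, hne, hmin⟩ := exists_minimalExponent hm hq hz' h1
  -- The minimal pivot `(i, j)` may differ from `(i₀, j₀)`, but there are at least three indices.
  obtain ⟨k, hki, hkj⟩ : ∃ k, k ≠ i ∧ k ≠ j := by
    by_contra hcon
    push Not at hcon h2
    obtain ⟨k₀, h3, h4⟩ := h2
    have h5 : i₀ ≠ j₀ := by
      rintro rfl
      exact h1 (hq.1 _)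
    have h6 : ({i₀, j₀, k₀} : Finset ι).card = 3 := Finset.card_eq_three.2
      ⟨i₀, j₀, k₀, h5, h3.symm, h4.symm, rfl⟩
    have h7 : ({i₀, j₀, k₀} : Finset ι) ⊆ {i, j} := fun x _ => by
      rw [Finset.mem_insert, Finset.mem_singleton]
      exact or_iff_not_imp_left.2 (hcon x)
    have h8 := Finset.card_le_card h7
    have h9 : ({i, j} : Finset ι).card ≤ 2 := Finset.card_le_two
    omega
  have hdvd := hmin.dvd_orderOf hz' hr hq'ij hne hki hkj
  obtain ⟨r, hr, hrij, h3⟩ := hmin.exists_reach_decoupled hq hz' hr hij hq'ij hne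
  have hdh : d ∣ h := dvd_of_pow_mem_zpowers hd (hrij ▸ hr.mem hz i j)
  have hr0 := hr.multAntisymm hq
  obtain ⟨R⟩ := ih (Fintype.card {k // k ≠ i ∧ k ≠ j})
    (hN ▸ Fintype.card_subtype_lt (x := i) (by simp)) hdvd
    (q := r.submatrix (Subtype.val : {k // k ≠ i ∧ k ≠ j} → ι) Subtype.val)
    ⟨fun _ => hr0.1 _, fun _ _ _ => hr0.inv_eq _ _⟩
    (fun k l => (h3 k k.2.1 k.2.2).2.2 l l.2.1 l.2.2) rfl
  exact BlockReduction.nonempty_of_decoupled hq hr hij hrij hne hdvd hdh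
    (fun k hki hkj => ⟨(h3 k hki hkj).1, (h3 k hki hkj).2.1⟩) R hki hkj

theorem nonempty_normalForm {n : ℕ} {q : Matrix (Fin n) (Fin n) Kˣ} (hq : MultAntisymm q)
    (hfin : Finite (paramGroup q)) {ζ : Kˣ} (hζ : Subgroup.zpowers ζ = paramGroup q) :
    Nonempty (NormalForm q ζ) := by
  have hm : 0 < orderOf ζ := by
    rw [← hζ] at hfin
    exact orderOf_pos_iff.2 (finite_zpowers.1 hfin)
  have hmem (k l) : q k l ∈ paramGroup q := Subgroup.subset_closure ⟨(k, l), rfl⟩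
  obtain ⟨⟨s, t, h, z, e, q', hr, hq', h1, h2, h3, -, h5, h6, h7⟩⟩ :=
    nonempty_blockReduction hm (one_dvd _) hq fun k l => by
      rw [pow_one, hζ]
      exact hmem k l
  obtain rfl : t = n - 2 * s := by
    have := Fintype.card_congr e
    simp only [Fintype.card_sum, Fintype.card_fin] at this
    omega
  have hs : 2 * s ≤ n := by
    have := Fintype.card_congr e
    simp only [Fintype.card_sum, Fintype.card_fin] at this
    omega
  obtain ⟨f⟩ := hr.nonempty_algEquiv hq
  obtain ⟨g⟩ := nonempty_algEquiv_of_equiv _ q' e fun x y => (hq' x y).symm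
  refine ⟨⟨s, hs, h, h1, fun i hi => ?_, fun i _ => h2 i, h3, z, h5, fun hn => h6 (by omega), h7,
    g.trans f⟩⟩
  -- Here `i` is the first index. All parameters are powers of `ζ ^ h i`, and shears preserve the
  -- group they generate, so `ζ` itself is such a power; as `h i` divides the order, `h i ∣ 1`.
  have hexp (x : Fin s) : ζ ^ exponent h z x ∈ Subgroup.zpowers (ζ ^ h i) := by
    have hdvd : h i ∣ exponent h z x := by
      have := h3 i x (Fin.le_def.2 (by omega))
      unfold exponent
      split_ifs
      · exact this.mul_left _
      · exact this
    obtain ⟨c, hc⟩ := hdvd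
    rw [hc, pow_mul]
    exact Subgroup.npow_mem_zpowers _ _
  have hq'mem (k l) : q' k l ∈ Subgroup.zpowers (ζ ^ h i) := by
    obtain ⟨x, rfl⟩ := e.surjective k
    obtain ⟨y, rfl⟩ := e.surjective l
    rw [hq']
    rcases x with x | x | x <;> rcases y with y | y | y <;> simp only [blockMatrix]
    any_goals exact one_mem _
    · split_ifs
      · exact hexp x
      · exact one_mem _
    · split_ifs
      · exact inv_mem (hexp x)
      · exact one_mem _
  have hle : paramGroup q ≤ Subgroup.zpowers (ζ ^ h i) := by
    rw [paramGroup, Subgroup.closure_le]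
    rintro _ ⟨p, rfl⟩
    exact hr.mem_of_mem hq hq'mem _ _
  have hζ' : ζ ^ 1 ∈ Subgroup.zpowers (ζ ^ h i) := by
    rw [pow_one]
    exact hle (hζ ▸ Subgroup.mem_zpowers ζ)
  exact Nat.dvd_one.1 (dvd_of_pow_mem_zpowers (h1 i) hζ')

end BlockReduction

/-! ### Extending simple modules from quantum space to the torus -/

section Extension

variable {K : Type u} [Field K] {ι : Type} {q : Matrix ι ι Kˣ}

/-- The generators of the quantum affine space are normal elements. -/
lemma QuantumAffine.x_normal (i : ι) (a : QuantumAffine q) :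
    (∃ b, x q i * a = b * x q i) ∧ ∃ b, a * x q i = x q i * b := by
  induction a using QuantumAffine.induction with
  | hK r => exact ⟨⟨_, (Algebra.commutes r _).symm⟩, ⟨_, Algebra.commutes r _⟩⟩
  | hx j =>
    refine ⟨⟨(q i j : K) • x q j, ?_⟩, ⟨(q j i : K) • x q j, ?_⟩⟩
    · rw [x_mul_x, smul_mul_assoc]
    · rw [x_mul_x, mul_smul_comm]
  | hadd a b ha hb =>
    obtain ⟨⟨a₁, h₁⟩, a₂, h₂⟩ := ha
    obtain ⟨⟨b₁, h₃⟩, b₂, h₄⟩ := hb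
    exact ⟨⟨a₁ + b₁, by rw [mul_add, add_mul, h₁, h₃]⟩, a₂ + b₂, by rw [mul_add, add_mul, h₂, h₄]⟩
  | hmul a b ha hb =>
    obtain ⟨⟨a₁, h₁⟩, a₂, h₂⟩ := ha
    obtain ⟨⟨b₁, h₃⟩, b₂, h₄⟩ := hb
    exact ⟨⟨a₁ * b₁, by rw [← mul_assoc, h₁, mul_assoc, h₃, mul_assoc]⟩,
      a₂ * b₂, by rw [mul_assoc, h₄, ← mul_assoc, h₂, mul_assoc]⟩

/-- A generator that acts nontrivially on a simple module acts bijectively. -/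
lemma bijective_x_smul {N : Type*} [AddCommGroup N] [Module (QuantumAffine q)ᵐᵒᵖ N]
    [IsSimpleModule (QuantumAffine q)ᵐᵒᵖ N] {i : ι}
    (h : ∃ v : N, op (QuantumAffine.x q i) • v ≠ 0) :
    Function.Bijective fun v : N => op (QuantumAffine.x q i) • v := by
  obtain ⟨v₀, hv₀⟩ := h
  -- Normality of the generator makes both its image `R` and its kernel `L` submodules; simplicity
  -- then decides what they are.
  let R : Submodule (QuantumAffine q)ᵐᵒᵖ N :=
    { carrier := {w | ∃ v : N, op (QuantumAffine.x q i) • v = w}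
      zero_mem' := ⟨0, smul_zero _⟩
      add_mem' := by
        rintro _ _ ⟨v, rfl⟩ ⟨w, rfl⟩
        exact ⟨v + w, smul_add _ _ _⟩
      smul_mem' := by
        rintro a _ ⟨v, rfl⟩
        obtain ⟨b, hb⟩ := (QuantumAffine.x_normal i a.unop).1
        refine ⟨op b • v, ?_⟩
        rw [smul_smul, smul_smul, ← op_mul, ← hb, op_mul, op_unop] }
  let L : Submodule (QuantumAffine q)ᵐᵒᵖ N :=
    { carrier := {v | op (QuantumAffine.x q i) • v = 0}
      zero_mem' := smul_zero _
      add_mem' := fun {v w} hv hw => by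
        rw [Set.mem_ofPred_eq] at hv hw ⊢
        rw [smul_add, hv, hw, add_zero]
      smul_mem' := fun a v hv => by
        rw [Set.mem_ofPred_eq] at hv ⊢
        obtain ⟨b, hb⟩ := (QuantumAffine.x_normal i a.unop).2
        rw [smul_smul, ← op_unop a, ← op_mul, hb, op_mul, mul_smul, hv, smul_zero] }
  constructor
  · have hL : L = ⊥ := (eq_bot_or_eq_top L).resolve_right fun h =>
      hv₀ ((h ▸ Submodule.mem_top : v₀ ∈ L))
    intro v w hvw
    have h1 : v - w ∈ L := by
      change _ • (v - w) = 0
      rw [smul_sub, sub_eq_zero]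
      exact hvw
    rwa [hL, Submodule.mem_bot, sub_eq_zero] at h1
  · have hR : R = ⊤ := (eq_bot_or_eq_top R).resolve_left fun h =>
      hv₀ ((Submodule.mem_bot (QuantumAffine q)ᵐᵒᵖ).1 (h ▸ (⟨v₀, rfl⟩ : op (QuantumAffine.x q i) • v₀ ∈ R)))
    intro w
    exact (hR ▸ Submodule.mem_top : w ∈ R)

end Extension

section ExtensionFin

variable {K : Type u} [Field K] {n : ℕ} {q : Matrix (Fin n) (Fin n) Kˣ}

lemma exists_extendsAction {N : Type*} [AddCommGroup N] [Module (QuantumAffine q)ᵐᵒᵖ N]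
    (h : ∀ i, Function.Bijective fun v : N => op (QuantumAffine.x q i) • v) :
    ∃ _inst : Module (QuantumTorus q)ᵐᵒᵖ N, ExtendsAction q N := by
  let : Module K N := Module.compHom N (algebraMap K (QuantumAffine q)ᵐᵒᵖ)
  have : IsScalarTower K (QuantumAffine q)ᵐᵒᵖ N := ⟨fun r a v => by
    rw [Algebra.smul_def, mul_smul]
    rfl⟩
  let ρ : QuantumAffine q →ₐ[K] (Module.End K N)ᵐᵒᵖ :=
    AlgHom.opComm.symm (Algebra.lsmul K K N)
  have hρ (i) : IsUnit (ρ (QuantumAffine.x q i)) :=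
    isUnit_op.2 ((Module.End.isUnit_iff _).2 (h i))
  choose f hf using hρ
  let φ : QuantumTorus q →ₐ[K] (Module.End K N)ᵐᵒᵖ := QuantumTorus.lift f fun i j => by
    rw [hf, hf, ← map_mul, ← map_mul, QuantumAffine.x_mul_x, map_smul]
  have hφ (a) : φ (toTorus q a) = ρ a := by
    induction a using QuantumAffine.induction with
    | hK r => rw [AlgHom.commutes, AlgHom.commutes, AlgHom.commutes]
    | hx i => rw [toTorus_x, QuantumTorus.lift_x, hf]
    | hadd a b ha hb => rw [map_add, map_add, map_add, ha, hb]
    | hmul a b ha hb => rw [map_mul, map_mul, map_mul, ha, hb]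
  refine ⟨Module.compHom N (AlgHom.opComm φ).toRingHom, fun a v => ?_⟩
  exact congrArg (fun g : (Module.End K N)ᵐᵒᵖ => g.unop v) (hφ a)

/-- An inverse generator must act as the inverse of an operator that is already prescribed, and
inverses are unique. -/
lemma extendsAction_unique {N : Type*} [AddCommGroup N] [Module (QuantumAffine q)ᵐᵒᵖ N]
    (M₁ M₂ : Module (QuantumTorus q)ᵐᵒᵖ N) (h₁ : @ExtendsAction K _ n q N _ _ M₁)
    (h₂ : @ExtendsAction K _ n q N _ _ M₂) : M₁ = M₂ := by
  let φ₁ := @Module.toAddMonoidEnd (QuantumTorus q)ᵐᵒᵖ N _ _ M₁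
  let φ₂ := @Module.toAddMonoidEnd (QuantumTorus q)ᵐᵒᵖ N _ _ M₂
  have h (a) : φ₁ (op (toTorus q a)) = φ₂ (op (toTorus q a)) :=
    AddMonoidHom.ext fun v => (h₁ a v).trans (h₂ a v).symm
  have key (a : QuantumTorus q) : φ₁ (op a) = φ₂ (op a) := by
    induction a using QuantumTorus.induction with
    | hK r => simpa using h (algebraMap K _ r)
    | hx i => simpa using h (QuantumAffine.x q i)
    | hx' i =>
      have hi := h (QuantumAffine.x q i)
      rw [toTorus_x] at hi
      refine left_inv_eq_right_inv (a := φ₁ (op (QuantumTorus.x q i))) ?_ ?_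
      · rw [← map_mul, ← op_mul, ← QuantumTorus.val_xUnit, Units.mul_inv, op_one, map_one]
      · rw [hi, ← map_mul, ← op_mul, ← QuantumTorus.val_xUnit, Units.inv_mul, op_one, map_one]
    | hadd a b ha hb => rw [op_add, map_add, map_add, ha, hb]
    | hmul a b ha hb => rw [op_mul, map_mul, map_mul, ha, hb]
  exact Module.ext' _ _ fun a v => DFunLike.congr_fun (key a.unop) v

lemma ExtendsAction.isSimpleModule {N : Type*} [AddCommGroup N] [Module (QuantumAffine q)ᵐᵒᵖ N]
    [Module (QuantumTorus q)ᵐᵒᵖ N] [IsSimpleModule (QuantumAffine q)ᵐᵒᵖ N]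
    (h : ExtendsAction q N) : IsSimpleModule (QuantumTorus q)ᵐᵒᵖ N := by
  have : Nontrivial N := IsSimpleModule.nontrivial (QuantumAffine q)ᵐᵒᵖ N
  refine (isSimpleModule_iff _ _).2 { eq_bot_or_eq_top := fun P => ?_ }
  let P' : Submodule (QuantumAffine q)ᵐᵒᵖ N :=
    { P.toAddSubmonoid with
      smul_mem' := fun a v hv => by
        rw [← op_unop a, ← h]
        exact P.smul_mem _ hv }
  refine (eq_bot_or_eq_top P').imp (fun hP => ?_) fun hP => ?_
  · exact SetLike.ext fun v => SetLike.ext_iff.1 hP v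
  · exact SetLike.ext fun v => SetLike.ext_iff.1 hP v

end ExtensionFin

/-! ### Finite dimension and central characters -/

section CentralCharacter

/-- If a commutative polynomial ring acts on a simple module by endomorphisms, such that the module
is finite over it, then it acts through a point of affine space. -/
lemma exists_forall_smul_eq_eval_smul {K : Type*} [Field K] [IsAlgClosed K] {σ : Type*} [Finite σ]
    (S : Type*) [Ring S] (N : Type*) [AddCommGroup N] [Module K N] [Module S N] [IsSimpleModule S N]
    [Module (MvPolynomial σ K) N] [IsScalarTower K (MvPolynomial σ K) N]
    [SMulCommClass (MvPolynomial σ K) S N] [Module.Finite (MvPolynomial σ K) N] :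
    ∃ x : σ → K, ∀ (f : MvPolynomial σ K) (v : N), f • v = MvPolynomial.eval x f • v := by
  have : Nontrivial N := IsSimpleModule.nontrivial S N
  have hmax : (Module.annihilator (MvPolynomial σ K) N).IsMaximal := by
    rw [Ideal.isMaximal_iff]
    constructor
    · intro h
      obtain ⟨v, hv⟩ := exists_ne (0 : N)
      exact hv (by simpa using Module.mem_annihilator.1 h v)
    · intro J f hJ hf hfJ
      -- As `f` acts `S`-linearly and not as zero, `f N = N`. Nakayama then yields `r ≡ 1` modulo
      -- `f` that annihilates `N`, so any ideal containing the annihilator and `f` is everything.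
      have hsurj : Function.Surjective (DistribSMul.toLinearMap S N f) := by
        refine (LinearMap.surjective_or_eq_zero _).resolve_right fun h => hf ?_
        exact Module.mem_annihilator.2 fun v => DFunLike.congr_fun h v
      obtain ⟨r, hr, hr'⟩ := Submodule.exists_sub_one_mem_and_smul_eq_zero_of_fg_of_le_smul
        (Ideal.span {f}) (⊤ : Submodule (MvPolynomial σ K) N) Module.Finite.fg_top fun v _ => by
          obtain ⟨w, rfl⟩ := hsurj v
          exact Submodule.smul_mem_smul (Ideal.mem_span_singleton_self f) trivial
      have h1 : r ∈ J := hJ (Module.mem_annihilator.2 fun v => hr' v trivial)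
      have h2 : r - 1 ∈ J := (Ideal.span_singleton_le_iff_mem J).2 hfJ hr
      simpa using sub_mem h1 h2
  obtain ⟨x, hx⟩ := MvPolynomial.isMaximal_iff_eq_vanishingIdeal_singleton.1 hmax
  refine ⟨x, fun f v => ?_⟩
  have h1 : f - MvPolynomial.C (MvPolynomial.eval x f) ∈
      Module.annihilator (MvPolynomial σ K) N := by
    rw [hx, MvPolynomial.mem_vanishingIdeal_singleton_iff]
    simp [MvPolynomial.aeval_eq_eval]
  have h2 := Module.mem_annihilator.1 h1 v
  rw [sub_smul, sub_eq_zero] at h2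
  rw [h2, ← MvPolynomial.algebraMap_eq, algebraMap_smul]

variable {K : Type u} [Field K] {ι : Type} {q : Matrix ι ι Kˣ}

lemma QuantumTorus.x_pow_mul_x (i j : ι) (n : ℕ) :
    x q i ^ n * x q j = ((q i j : K) ^ n) • (x q j * x q i ^ n) := by
  induction n with
  | zero => simp
  | succ n ih =>
    rw [pow_succ, mul_assoc, x_mul_x, mul_smul_comm, ← mul_assoc, ih, smul_mul_assoc, smul_smul,
      mul_assoc, pow_succ, mul_comm]

lemma QuantumTorus.commute_x_pow {i : ι} {n : ℕ} (h : ∀ j, q i j ^ n = 1) (a : QuantumTorus q) :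
    Commute (x q i ^ n) a := by
  have hx (j) : Commute (x q i ^ n) (x q j) := by
    rw [Commute, SemiconjBy, x_pow_mul_x, ← Units.val_pow_eq_pow_val, h, Units.val_one, one_smul]
  induction a using QuantumTorus.induction with
  | hK r => exact (Algebra.commutes r _).symm
  | hx j => exact hx j
  | hx' j => exact Commute.units_inv_right (hx j)
  | hadd a b ha hb => exact ha.add_right hb
  | hmul a b ha hb => exact ha.mul_right hb

/-- Simple modules over a quantum torus with parameters of finite order are finite-dimensional, and
central powers of the generators act by scalars. -/
lemma exists_scalar_of_isSimpleModule [IsAlgClosed K] [Finite ι] {p : ι → ℕ} (hp : ∀ i, 0 < p i)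
    (hpq : ∀ i j, q i j ^ p i = 1) (N : Type*) [AddCommGroup N] [Module K N]
    [Module (QuantumTorus q)ᵐᵒᵖ N] [IsScalarTower K (QuantumTorus q)ᵐᵒᵖ N]
    [IsSimpleModule (QuantumTorus q)ᵐᵒᵖ N] :
    Module.Finite K N ∧ ∃ c : ι → K, ∀ i (v : N), op (QuantumTorus.x q i ^ p i) • v = c i • v := by
  classical
  have := Fintype.ofFinite ι
  -- The inverses of the central powers are included so that `x⁻¹ = x ^ (p - 1) * (x ^ p)⁻¹` is
  -- reached from positive powers and `R`.
  let z : ι ⊕ ι → Subalgebra.center K (QuantumTorus q)ᵐᵒᵖ := Sum.elim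
    (fun i => ⟨op (QuantumTorus.x q i ^ p i), Subalgebra.mem_center_iff.2 fun a =>
      unop_injective (QuantumTorus.commute_x_pow (hpq i) a.unop).eq⟩)
    (fun i => ⟨op (((QuantumTorus.xUnit q i ^ p i)⁻¹ : (QuantumTorus q)ˣ) : QuantumTorus q),
      Subalgebra.mem_center_iff.2 fun a => unop_injective
        (Commute.units_inv_left (u := QuantumTorus.xUnit q i ^ p i) (a := a.unop) (by
          rw [Units.val_pow_eq_pow_val]
          exact QuantumTorus.commute_x_pow (hpq i) a.unop)).eq⟩)
  let R := MvPolynomial (ι ⊕ ι) K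
  let θ : R →ₐ[K] Subalgebra.center K (QuantumTorus q)ᵐᵒᵖ := MvPolynomial.aeval z
  let : Module R N := Module.compHom N θ.toRingHom
  have hR (f : R) (v : N) : f • v = (θ f : (QuantumTorus q)ᵐᵒᵖ) • v := rfl
  have hcomm (f : R) (a : (QuantumTorus q)ᵐᵒᵖ) (v : N) : f • a • v = a • f • v := by
    rw [hR, hR, smul_smul, smul_smul, Subalgebra.mem_center_iff.1 (θ f).2 a]
  have : SMulCommClass R (QuantumTorus q)ᵐᵒᵖ N := ⟨hcomm⟩
  have : SMulCommClass (QuantumTorus q)ᵐᵒᵖ R N := SMulCommClass.symm _ _ _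
  have : IsScalarTower K R N := ⟨fun r f v => by
    rw [hR, hR, map_smul, ← smul_assoc]
    rfl⟩
  have hX (i : ι) (v : N) : (MvPolynomial.X (Sum.inl i) : R) • v =
      op (QuantumTorus.x q i ^ p i) • v := by
    rw [hR, MvPolynomial.aeval_X]
    rfl
  have hX' (i : ι) (v : N) : (MvPolynomial.X (Sum.inr i) : R) • v =
      op (((QuantumTorus.xUnit q i ^ p i)⁻¹ : (QuantumTorus q)ˣ) : QuantumTorus q) • v := by
    rw [hR, MvPolynomial.aeval_X]
    rfl
  have : Nontrivial N := IsSimpleModule.nontrivial (QuantumTorus q)ᵐᵒᵖ N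
  obtain ⟨v₀, hv₀⟩ := exists_ne (0 : N)
  -- The generators are treated one at a time. To gain stability under `x i`, the translates of `W`
  -- by `x i ^ e` with `e < p i` suffice, since `x i ^ p i` acts through `R`; stability under
  -- earlier generators survives because they commute with `x i` up to scalars.
  have key (s : Finset ι) : ∃ W : Submodule R N, W.FG ∧ v₀ ∈ W ∧
      ∀ i ∈ s, ∀ w ∈ W, op (QuantumTorus.x q i) • w ∈ W := by
    induction s using Finset.induction_on with
    | empty => exact ⟨Submodule.span R {v₀}, Submodule.fg_span_singleton _,
        Submodule.mem_span_singleton_self _, by simp⟩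
    | insert i s _ ih =>
      obtain ⟨W, hW, hv, hs⟩ := ih
      let V (e : ℕ) : Submodule R N :=
        W.map (DistribSMul.toLinearMap R N (op (QuantumTorus.x q i ^ e)))
      have hV (e : ℕ) {w : N} (hw : w ∈ W) (he : e < p i) :
          op (QuantumTorus.x q i ^ e) • w ∈ ⨆ e : Fin (p i), V e :=
        Submodule.mem_iSup_of_mem (⟨e, he⟩ : Fin (p i)) ⟨w, hw, rfl⟩
      refine ⟨⨆ e : Fin (p i), V e, Submodule.fg_iSup _ fun e => hW.map _, ?_, ?_⟩
      · simpa using hV 0 hv (hp i)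
      · intro j hj w hw
        induction hw using Submodule.iSup_induction' with
        | zero => rw [smul_zero]; exact zero_mem _
        | add v w _ _ hv hw => rw [smul_add]; exact add_mem hv hw
        | mem e w hw =>
          obtain ⟨w, hw, rfl⟩ := hw
          change op (QuantumTorus.x q j) • op (QuantumTorus.x q i ^ (e : ℕ)) • w ∈ _
          rw [smul_smul, ← op_mul]
          rcases Finset.mem_insert.1 hj with rfl | hj
          · rw [← pow_succ]
            rcases (Nat.succ_le_of_lt e.2).lt_or_eq with he | he
            · exact hV _ hw he
            · rw [Nat.succ_eq_add_one] at he
              rw [he, ← hX]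
              refine Submodule.smul_mem _ _ ?_
              simpa using hV 0 hw (hp j)
          · rw [QuantumTorus.x_pow_mul_x, op_smul, op_mul, smul_assoc, mul_smul,
              ← algebraMap_smul R]
            exact Submodule.smul_mem _ _ (hV _ (hs j hj w hw) e.2)
  obtain ⟨W, hW, hv, hs⟩ := key Finset.univ
  have hWx (i : ι) (w : N) (hw : w ∈ W) : op (QuantumTorus.x q i) • w ∈ W :=
    hs i (Finset.mem_univ _) w hw
  have hWx' (i : ι) (e : ℕ) (w : N) (hw : w ∈ W) : op (QuantumTorus.x q i ^ e) • w ∈ W := by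
    induction e with
    | zero => simpa using hw
    | succ e ih =>
      rw [pow_succ, op_mul, mul_smul]
      exact hWx _ _ ih
  have hWa (a : QuantumTorus q) : ∀ w ∈ W, op a • w ∈ W := by
    induction a using QuantumTorus.induction with
    | hK r =>
      intro w hw
      rw [← MulOpposite.algebraMap_apply, algebraMap_smul, ← algebraMap_smul R]
      exact Submodule.smul_mem _ _ hw
    | hx i => exact hWx i
    | hx' i =>
      intro w hw
      have h1 : (QuantumTorus.xUnit q i)⁻¹ =
          QuantumTorus.xUnit q i ^ (p i - 1) * (QuantumTorus.xUnit q i ^ p i)⁻¹ := by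
        rw [eq_mul_inv_iff_mul_eq, inv_mul_eq_iff_eq_mul, ← pow_succ', Nat.sub_add_cancel (hp i)]
      rw [h1, Units.val_mul, op_mul, mul_smul, ← hX', Units.val_pow_eq_pow_val]
      exact Submodule.smul_mem _ _ (hWx' _ _ _ hw)
    | hadd a b ha hb =>
      intro w hw
      rw [op_add, add_smul]
      exact add_mem (ha w hw) (hb w hw)
    | hmul a b ha hb =>
      intro w hw
      rw [op_mul, mul_smul]
      exact hb _ (ha w hw)
  let W' : Submodule (QuantumTorus q)ᵐᵒᵖ N :=
    { W.toAddSubmonoid with smul_mem' := fun a w hw => hWa a.unop w hw }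
  have hW' : W' = ⊤ := (eq_bot_or_eq_top W').resolve_left fun h =>
    hv₀ ((Submodule.mem_bot _).1 (h ▸ hv : v₀ ∈ (⊥ : Submodule (QuantumTorus q)ᵐᵒᵖ N)))
  have hWtop : W = ⊤ := SetLike.ext fun v => SetLike.ext_iff.1 hW' v
  have : Module.Finite R N := ⟨hWtop ▸ hW⟩
  obtain ⟨x, hx⟩ := exists_forall_smul_eq_eval_smul (σ := ι ⊕ ι) (K := K) (QuantumTorus q)ᵐᵒᵖ N
  refine ⟨?_, fun i => x (Sum.inl i), fun i v => ?_⟩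
  · obtain ⟨S, hS⟩ := Module.Finite.fg_top (R := R) (M := N)
    refine ⟨S, eq_top_iff.2 fun v _ => ?_⟩
    have hv : v ∈ Submodule.span R (S : Set N) := hS ▸ Submodule.mem_top
    induction hv using Submodule.span_induction with
    | mem v hv => exact Submodule.subset_span hv
    | zero => exact zero_mem _
    | add v w _ _ hv hw => exact add_mem (hv trivial) (hw trivial)
    | smul f v _ hv =>
      rw [hx]
      exact Submodule.smul_mem _ _ (hv trivial)
  · rw [← hX, hx, MvPolynomial.eval_X]

end CentralCharacter

/-! ### Induction over products of cyclic groups -/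

section PiZMod

/-- A property of elements of a finite product of finite cyclic groups that is stable under addition
of the standard generators holds everywhere if it holds somewhere. -/
lemma pi_zmod_induction {s : ℕ} {k : Fin s → ℕ} (hk : ∀ i, 0 < k i) {P : (∀ i, ZMod (k i)) → Prop}
    {a₀ : ∀ i, ZMod (k i)} (h₀ : P a₀) (h : ∀ a i, P a → P (a + Pi.single i 1))
    (a : ∀ i, ZMod (k i)) : P a := by
  let D : AddSubmonoid (∀ i, ZMod (k i)) :=
    { carrier := {d | ∀ a, P a → P (a + d)}
      zero_mem' := fun a ha => by rwa [add_zero]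
      add_mem' := fun {d e} hd he a ha => by
        rw [← add_assoc]
        exact he _ (hd _ ha) }
  have h1 (i : Fin s) (x : ZMod (k i)) : Pi.single i x ∈ D := by
    have : NeZero (k i) := ⟨(hk i).ne'⟩
    have hx : Pi.single i x = x.val • (Pi.single i 1 : ∀ i, ZMod (k i)) := by
      rw [← Pi.single_smul, nsmul_eq_mul, mul_one, ZMod.natCast_zmod_val]
    rw [hx]
    exact D.nsmul_mem (fun a ha => h a i ha) _
  have h2 : a - a₀ ∈ D := by
    rw [← Finset.univ_sum_single (a - a₀)]
    exact D.sum_mem fun i _ => h1 i _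
  simpa using h2 a₀ h₀

end PiZMod

/-! ### Simplicity of the models -/

section ModelSimple

variable {K : Type u} [Field K] {s t : ℕ} {k : Fin s → ℕ} {c : Fin s → Kˣ}

/-- The two shifts cancel, so the product is diagonal. Its eigenvalue depends only on the `i`-th
coordinate, and is used to tell basis vectors apart. -/
lemma shiftMap_shiftMap_apply (α : BlockIndex s t → Kˣ) (i : Fin s)
    (f : (∀ i, ZMod (k i)) →₀ K) (b : ∀ i, ZMod (k i)) :
    shiftMap (blockCoeff k c α (Sum.inl i)) (blockShift k (Sum.inl i : BlockIndex s t))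
      (shiftMap (blockCoeff k c α (Sum.inr (Sum.inl i)))
        (blockShift k (Sum.inr (Sum.inl i) : BlockIndex s t)) f) b =
      (α (Sum.inr (Sum.inl i)) * c i ^ (((b i).cast : ℤ) - 1) : Kˣ) * f b := by
  classical
  induction f using Finsupp.induction_linear with
  | zero => simp
  | add f g hf hg => rw [map_add, map_add, Finsupp.add_apply, hf, hg, Finsupp.add_apply, mul_add]
  | single a r =>
    have h : a + Pi.single i (-1) + Pi.single i 1 = a := by
      rw [add_assoc, ← Pi.single_add, neg_add_cancel, Pi.single_zero, add_zero]
    rw [shiftMap_single, shiftMap_single]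
    simp only [blockShift, blockCoeff, h]
    rcases eq_or_ne a b with rfl | hab
    · simp only [Finsupp.single_eq_same, Units.val_mul]
      rw [mul_comm _ r, mul_assoc r, mul_right_comm _ _ (α (Sum.inl i) : K), mul_right_comm _ _
        (α (Sum.inl i) : K), Units.inv_mul, one_mul]
    · simp [Finsupp.single_eq_of_ne hab.symm]

/-- A subspace of the model that is stable under the generators is trivial. -/
lemma eq_bot_or_eq_top_of_shiftMap_mem (hk : ∀ i, 0 < k i) (hc : ∀ i, orderOf (c i) = k i)
    (α : BlockIndex s t → Kˣ) (P : Submodule K ((∀ i, ZMod (k i)) →₀ K))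
    (hP : ∀ x, ∀ f ∈ P, shiftMap (blockCoeff k c α x) (blockShift k x) f ∈ P) :
    P = ⊥ ∨ P = ⊤ := by
  classical
  refine or_iff_not_imp_left.2 fun hbot => ?_
  obtain ⟨f, hf, hf0⟩ := Submodule.exists_mem_ne_zero_of_ne_bot hbot
  obtain ⟨a₀, ha₀⟩ : ∃ a, Finsupp.single a 1 ∈ P := by
    induction hN : f.support.card using Nat.strong_induction_on generalizing f with
    | _ N ih =>
    obtain ⟨b, hb⟩ := Finsupp.ne_iff.1 hf0
    by_cases hsub : ∀ a, f a ≠ 0 → a = b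
    · refine ⟨b, ?_⟩
      have h1 : f = Finsupp.single b (f b) := by
        ext a
        rcases eq_or_ne b a with rfl | h
        · rw [Finsupp.single_eq_same]
        · rw [Finsupp.single_eq_of_ne h.symm]
          by_contra h'
          exact h (hsub a h').symm
      have h2 : Finsupp.single b 1 = (f b)⁻¹ • f := by
        rw [h1, Finsupp.smul_single, Finsupp.single_eq_same, smul_eq_mul, inv_mul_cancel₀ hb]
      rw [h2]
      exact P.smul_mem _ hf
    · push Not at hsub
      obtain ⟨a, ha, hab⟩ := hsub
      obtain ⟨i, hi⟩ := Function.ne_iff.1 hab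
      set w : (∀ i, ZMod (k i)) → Kˣ :=
        fun b => α (Sum.inr (Sum.inl i)) * c i ^ (((b i).cast : ℤ) - 1) with hw
      -- As `c i` has exact order `k i`, different coordinates give different eigenvalues.
      -- Subtracting `w a • f` therefore removes `a` from the support and keeps `b`, so the support
      -- shrinks without vanishing.
      have hwab : w a ≠ w b := by
        intro h
        have h1 := mul_left_cancel h
        rw [zpow_sub, zpow_sub, mul_left_inj, zpow_eq_zpow_iff_modEq, hc,
          ← ZMod.intCast_eq_intCast_iff] at h1
        simp at h1
        exact hi h1
      have hg := P.sub_mem (hP (Sum.inl i) _ (hP (Sum.inr (Sum.inl i)) _ hf))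
        (P.smul_mem (w a : K) hf)
      have hgx (x) := shiftMap_shiftMap_apply (c := c) α i f x
      set g := shiftMap (blockCoeff k c α (Sum.inl i)) (blockShift k (Sum.inl i : BlockIndex s t))
        (shiftMap (blockCoeff k c α (Sum.inr (Sum.inl i)))
          (blockShift k (Sum.inr (Sum.inl i) : BlockIndex s t)) f)
      have hg' (x) : (g - (w a : K) • f) x = (w x - w a : K) * f x := by
        rw [Finsupp.sub_apply, hgx, Finsupp.smul_apply, smul_eq_mul, ← sub_mul]
      refine ih _ ?_ (g - (w a : K) • f) hg ?_ rfl
      · rw [← hN]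
        refine Finset.card_lt_card (Finset.ssubset_iff_of_subset ?_ |>.2 ⟨a, by simpa using ha, ?_⟩)
        · intro x hx
          rw [Finsupp.mem_support_iff, hg'] at hx
          exact Finsupp.mem_support_iff.2 (right_ne_zero_of_mul hx)
        · simp [hg']
      · refine Finsupp.ne_iff.2 ⟨b, ?_⟩
        rw [hg']
        exact mul_ne_zero (sub_ne_zero.2 fun h => hwab (Units.ext h.symm)) hb
  have h1 (a) : Finsupp.single a 1 ∈ P := by
    refine pi_zmod_induction (P := fun a => Finsupp.single a 1 ∈ P) hk ha₀ (fun a i ha => ?_) a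
    have h2 := P.smul_mem ((α (Sum.inl i))⁻¹ : Kˣ).val (hP (Sum.inl i) _ ha)
    rw [shiftMap_single, Finsupp.smul_single] at h2
    simpa [blockShift, blockCoeff] using h2
  refine eq_top_iff.2 fun f _ => ?_
  induction f using Finsupp.induction_linear with
  | zero => exact zero_mem _
  | add f g hf hg => exact add_mem (hf trivial) (hg trivial)
  | single a r => simpa using P.smul_mem r (h1 a)

end ModelSimple

/-! ### Common eigenvectors -/

section JointEigenvector

/-- Finitely many commuting endomorphisms of a nonzero finite-dimensional vector space over an
algebraically closed field have a common eigenvector. -/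
lemma exists_joint_eigenvector {K V κ : Type*} [Field K] [IsAlgClosed K] [AddCommGroup V]
    [Module K V] [Module.Finite K V] [Nontrivial V] [Finite κ] (f : κ → Module.End K V)
    (hf : ∀ i j, Commute (f i) (f j)) : ∃ v : V, v ≠ 0 ∧ ∃ μ : κ → K, ∀ i, f i v = μ i • v := by
  classical
  have := Fintype.ofFinite κ
  have key (s : Finset κ) : ∃ E : Submodule K V, E ≠ ⊥ ∧ (∀ i, ∀ v ∈ E, f i v ∈ E) ∧
      ∃ μ : κ → K, ∀ i ∈ s, ∀ v ∈ E, f i v = μ i • v := by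
    induction s using Finset.induction_on with
    | empty => exact ⟨⊤, top_ne_bot, fun _ _ _ => trivial, 0, by simp⟩
    | insert j s hj ih =>
      obtain ⟨E, hE, hE', μ, hμ⟩ := ih
      have : Nontrivial E := Submodule.nontrivial_iff_ne_bot.2 hE
      obtain ⟨ν, hν⟩ := Module.End.exists_eigenvalue ((f j).restrict (hE' j))
      obtain ⟨w, hw⟩ := hν.exists_hasEigenvector
      refine ⟨E ⊓ (f j).eigenspace ν, ?_, ?_, Function.update μ j ν, ?_⟩
      · refine Submodule.ne_bot_iff _ |>.2 ⟨w, ⟨w.2, Module.End.mem_eigenspace_iff.2 ?_⟩, ?_⟩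
        · exact congrArg Subtype.val hw.apply_eq_smul
        · exact fun h => hw.2 (Subtype.ext h)
      · rintro i v ⟨hv, hv'⟩
        refine ⟨hE' i v hv, Module.End.mem_eigenspace_iff.2 ?_⟩
        have h1 : f j (f i v) = f i (f j v) := LinearMap.congr_fun (hf j i).eq v
        rw [h1, Module.End.mem_eigenspace_iff.1 hv', map_smul]
      · rintro i hi v ⟨hv, hv'⟩
        rcases eq_or_ne i j with rfl | hij
        · rw [Function.update_self, Module.End.mem_eigenspace_iff.1 hv']
        · rw [Function.update_of_ne hij, hμ i ((Finset.mem_insert.1 hi).resolve_left hij) v hv]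
  obtain ⟨E, hE, -, μ, hμ⟩ := key Finset.univ
  obtain ⟨v, hv, hv0⟩ := Submodule.exists_mem_ne_zero_of_ne_bot hE
  exact ⟨v, hv0, μ, fun i => hμ i (Finset.mem_univ _) v hv⟩

end JointEigenvector

/-! ### Mapping a model into a simple module -/

section Intertwiner

/-- Encodes the monomials in the rescaled `X i`, so that `e (a + single i 1)` needs no case
distinction at the wrap-around modulo `k i`. -/
lemma exists_addMonoidHom_pi_zmod {s : ℕ} (k : Fin s → ℕ) {G : Type*} [Group G] (S : Fin s → G)
    (hS : ∀ i, S i ^ k i = 1) (hcomm : ∀ i j, Commute (S i) (S j)) :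
    ∃ φ : (∀ i, ZMod (k i)) →+ Additive G, ∀ i, φ (Pi.single i 1) = Additive.ofMul (S i) := by
  let ψ (i : Fin s) : ZMod (k i) →+ Additive G := ZMod.lift (k i)
    ⟨zmultiplesHom _ (Additive.ofMul (S i)), by
      rw [zmultiplesHom_apply, natCast_zsmul, ← ofMul_pow, hS, ofMul_one]⟩
  have hψ (i : Fin s) (x : ℤ) : ψ i x = x • Additive.ofMul (S i) := by
    rw [ZMod.lift_coe, zmultiplesHom_apply]
  have hψc : Pairwise fun i j => ∀ x y, AddCommute (ψ i x) (ψ j y) := by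
    intro i j _ x y
    obtain ⟨x, rfl⟩ := ZMod.intCast_surjective x
    obtain ⟨y, rfl⟩ := ZMod.intCast_surjective y
    have h : AddCommute (Additive.ofMul (S i)) (Additive.ofMul (S j)) :=
      congrArg Additive.ofMul (hcomm i j).eq
    rw [hψ, hψ]
    exact h.zsmul_zsmul x y
  refine ⟨AddMonoidHom.noncommPiCoprod ψ hψc, fun i => ?_⟩
  rw [AddMonoidHom.noncommPiCoprod_single, ← Int.cast_one, hψ, one_zsmul]

variable {K : Type u} [Field K] {s t : ℕ} {k : Fin s → ℕ} {c : Fin s → Kˣ}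

lemma blockMatrix_pow (hc : ∀ i, c i ^ k i = 1) (x y : BlockIndex s t) :
    blockMatrix c x y ^ (Sum.elim k (Sum.elim k fun _ => 1) : BlockIndex s t → ℕ) x = 1 := by
  rcases x with x | x | x <;> rcases y with y | y | y <;> simp only [blockMatrix] <;>
    try split_ifs
  all_goals simp [hc]

lemma blockRep_x_single (hc : ∀ i, c i ^ k i = 1) (α : BlockIndex s t → Kˣ) (x : BlockIndex s t)
    (f : (∀ i, ZMod (k i)) →₀ K) :
    (blockRep k c hc α (QuantumTorus.x _ x)).unop f =
      shiftMap (blockCoeff k c α x) (blockShift k x) f := by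
  rw [blockRep, QuantumTorus.lift_x]
  rfl

/-- A linear map that intertwines the actions of the generators is a module homomorphism. -/
lemma map_blockRep {N : Type*} [AddCommGroup N] [Module K N]
    [Module (QuantumTorus (blockMatrix (t := t) c))ᵐᵒᵖ N]
    [IsScalarTower K (QuantumTorus (blockMatrix (t := t) c))ᵐᵒᵖ N]
    (hc : ∀ i, c i ^ k i = 1) (α : BlockIndex s t → Kˣ) (g : ((∀ i, ZMod (k i)) →₀ K) →ₗ[K] N)
    (hg : ∀ (x : BlockIndex s t) (a : ∀ i, ZMod (k i)),
      (blockCoeff k c α x a : K) • g (Finsupp.single (a + blockShift k x) 1) =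
        op (QuantumTorus.x (blockMatrix c) x) • g (Finsupp.single a 1))
    (a : QuantumTorus (blockMatrix (t := t) c)) (m : (∀ i, ZMod (k i)) →₀ K) :
    g ((blockRep k c hc α a).unop m) = op a • g m := by
  have hx (x : BlockIndex s t) (m : (∀ i, ZMod (k i)) →₀ K) :
      g ((blockRep k c hc α (QuantumTorus.x (blockMatrix c) x)).unop m) =
        op (QuantumTorus.x (blockMatrix c) x) • g m := by
    rw [blockRep_x_single]
    induction m using Finsupp.induction_linear with
    | zero => simp
    | add m m' h h' => rw [map_add, map_add, map_add, smul_add, h, h']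
    | single b r =>
      have h1 : Finsupp.single b r = r • Finsupp.single b (1 : K) := by simp
      have h2 : Finsupp.single (b + blockShift k x) (r * (blockCoeff k c α x b : K)) =
        r • (blockCoeff k c α x b : K) • Finsupp.single (b + blockShift k x) (1 : K) := by simp
      rw [shiftMap_single, h2, h1, map_smul, map_smul, map_smul, hg, smul_comm]
  induction a using QuantumTorus.induction generalizing m with
  | hK r =>
    rw [AlgHom.commutes, MulOpposite.algebraMap_apply, unop_op, Module.algebraMap_end_apply,
      ← MulOpposite.algebraMap_apply, algebraMap_smul, map_smul]
  | hx x => exact hx x m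
  | hx' x =>
    have h1 := hx x ((blockRep k c hc α
      ((QuantumTorus.xUnit (blockMatrix c) x)⁻¹ : (QuantumTorus (blockMatrix c))ˣ)).unop m)
    rw [← Module.End.mul_apply, ← unop_mul, ← map_mul, ← QuantumTorus.val_xUnit, Units.inv_mul,
      map_one, unop_one, Module.End.one_apply] at h1
    rw [h1, smul_smul, ← op_mul, Units.mul_inv, op_one, one_smul]
  | hadd a b ha hb =>
    rw [map_add, unop_add, LinearMap.add_apply, map_add, ha, hb, op_add, add_smul]
  | hmul a b ha hb =>
    rw [map_mul, unop_mul, Module.End.mul_apply, hb, ha, op_mul, mul_smul]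

/-- Every simple module over a tensor product of rank two quantum tori and a group algebra
receives a nonzero homomorphism from one of the models. -/
theorem exists_intertwiner [IsAlgClosed K] (hk : ∀ i, 0 < k i) (hc : ∀ i, c i ^ k i = 1)
    (N : Type*) [AddCommGroup N] [Module K N]
    [Module (QuantumTorus (blockMatrix (t := t) c))ᵐᵒᵖ N]
    [IsScalarTower K (QuantumTorus (blockMatrix (t := t) c))ᵐᵒᵖ N]
    [IsSimpleModule (QuantumTorus (blockMatrix (t := t) c))ᵐᵒᵖ N] :
    ∃ (α : BlockIndex s t → Kˣ) (g : ((∀ i, ZMod (k i)) →₀ K) →ₗ[K] N), g ≠ 0 ∧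
      ∀ a m, g ((blockRep k c hc α a).unop m) = op a • g m := by
  classical
  set X := QuantumTorus.x (blockMatrix (t := t) c) with hX
  have : Nontrivial N := IsSimpleModule.nontrivial (QuantumTorus (blockMatrix (t := t) c))ᵐᵒᵖ N
  obtain ⟨hfin, l, hl⟩ := exists_scalar_of_isSimpleModule (q := blockMatrix (t := t) c)
    (p := Sum.elim k (Sum.elim k fun _ => 1))
    (by rintro (i | i | i) <;> simp [hk]) (blockMatrix_pow hc) N
  let L : (QuantumTorus (blockMatrix (t := t) c))ᵐᵒᵖ →ₐ[K] Module.End K N := Algebra.lsmul K K N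
  let U (x : BlockIndex s t) : (Module.End K N)ˣ := Units.map (MonoidHomClass.toMonoidHom L)
    (Units.opEquiv.symm (op (QuantumTorus.xUnit (blockMatrix (t := t) c) x)))
  have hU (x) (v : N) : (U x : Module.End K N) v = op (X x) • v := rfl
  have hUne (x) {v : N} (hv : v ≠ 0) : op (X x) • v ≠ 0 := fun h => hv <| by
    rw [← hU] at h
    have h1 := congrArg (((U x)⁻¹ : (Module.End K N)ˣ) : Module.End K N) h
    rwa [← Module.End.mul_apply, Units.inv_mul, map_zero] at h1
  have hXX (x y : BlockIndex s t) (h : blockMatrix c x y = 1) : Commute (X x) (X y) := by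
    have h1 := QuantumTorus.x_mul_x (q := blockMatrix (t := t) c) x y
    rwa [h, Units.val_one, one_smul] at h1
  have hcX (i : Fin s) : X (Sum.inl i) * X (Sum.inr (Sum.inl i)) =
      (c i : K) • (X (Sum.inr (Sum.inl i)) * X (Sum.inl i)) := by
    have h1 := QuantumTorus.x_mul_x (q := blockMatrix (t := t) c) (Sum.inl i) (Sum.inr (Sum.inl i))
    simpa only [blockMatrix, if_true] using h1
  have hXi (i j : Fin s) : Commute (X (Sum.inl i)) (X (Sum.inl j)) := hXX _ _ rfl
  have hXij {i j : Fin s} (hij : i ≠ j) : Commute (X (Sum.inl i)) (X (Sum.inr (Sum.inl j))) :=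
    hXX _ _ (if_neg hij)
  let Y (i : Fin s) := X (Sum.inr (Sum.inl i)) * X (Sum.inl i)
  have hY (i j : Fin s) : Commute (Y i) (Y j) := by
    rcases eq_or_ne i j with rfl | hij
    · exact Commute.refl _
    · exact ((hXX _ _ rfl).mul_right (hXij hij.symm).symm).mul_left
        ((hXij hij).mul_right (hXi _ _))
  have hXY (i j : Fin s) : X (Sum.inl j) * Y i = ((if j = i then c i else 1 : Kˣ) : K) •
      (Y i * X (Sum.inl j)) := by
    split_ifs with h
    · subst h
      rw [← mul_assoc, hcX, smul_mul_assoc]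
    · rw [Units.val_one, one_smul]
      exact (hXij h).mul_right (hXi _ _)
  obtain ⟨v, hv, μ, hμ⟩ := exists_joint_eigenvector (fun i => L (op (Y i))) fun i j =>
    Commute.map (f := L) (x := op (Y i)) (y := op (Y j)) (hY i j).op
  replace hμ (i) : op (Y i) • v = μ i • v := hμ i
  have hμ0 (i) : μ i ≠ 0 := by
    intro h
    have h1 := hμ i
    rw [h, zero_smul, op_mul, mul_smul] at h1
    exact hUne _ (hUne _ hv) h1
  have hl0 (x) : l x ≠ 0 := by
    intro h
    have h1 : ((U x ^ (Sum.elim k (Sum.elim k fun _ => 1) : BlockIndex s t → ℕ) x :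
        (Module.End K N)ˣ) : Module.End K N) v = l x • v := by
      rw [← hl]
      simp only [U, ← map_pow, ← op_pow]
      rfl
    rw [h, zero_smul] at h1
    have h2 := congrArg (((U x ^ (Sum.elim k (Sum.elim k fun _ => 1) : BlockIndex s t → ℕ) x)⁻¹ :
      (Module.End K N)ˣ) : Module.End K N) h1
    rw [← Module.End.mul_apply, Units.inv_mul, map_zero] at h2
    exact hv h2
  -- Dividing `X i` by a `k i`-th root of the scalar `X i ^ k i` makes its `k i`-th power act as the
  -- identity.
  have hroot (i : Fin s) : ∃ r : Kˣ, (r : K) ^ k i = l (Sum.inl i) := by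
    obtain ⟨r, hr⟩ := IsAlgClosed.exists_pow_nat_eq (l (Sum.inl i)) (hk i)
    refine ⟨Units.mk0 r fun h => hl0 (Sum.inl i) ?_, hr⟩
    rw [← hr, h, zero_pow (hk i).ne']
  choose β hβ using hroot
  -- In the model, `X (i+s) * X i` has eigenvalue `α (i+s) * c i ^ (-1)` at `e 0`. Matching it with
  -- `μ i` gives the factor `c i`.
  let α : BlockIndex s t → Kˣ := Sum.elim β (Sum.elim (fun i => c i * Units.mk0 (μ i) (hμ0 i))
    fun j => Units.mk0 (l (Sum.inr (Sum.inr j))) (hl0 _))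
  let σ : Kˣ →* (Module.End K N)ˣ := Units.map (algebraMap K (Module.End K N)).toMonoidHom
  have hσ (r : Kˣ) (v : N) : (σ r : Module.End K N) v = (r : K) • v :=
    Module.algebraMap_end_apply _ _ _ _ _
  have hσc (r : Kˣ) (w : (Module.End K N)ˣ) : Commute (σ r) w :=
    Units.ext (Algebra.commutes (r : K) (w : Module.End K N))
  have hUU (i j : Fin s) : Commute (U (Sum.inl i)) (U (Sum.inl j)) :=
    Units.ext (Commute.map (f := L) (hXi i j).op).eq
  obtain ⟨φ, hφ⟩ := exists_addMonoidHom_pi_zmod k (fun i => σ (β i)⁻¹ * U (Sum.inl i))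
    (fun i => by
      rw [(hσc _ _).mul_pow, ← map_pow, inv_pow, map_inv, inv_mul_eq_one]
      ext w
      rw [hσ, Units.val_pow_eq_pow_val, hβ, ← hl (Sum.inl i)]
      simp only [U, ← map_pow, ← op_pow]
      rfl)
    fun i j => ((hσc _ _).mul_right (hσc _ _)).mul_left ((hσc _ _).symm.mul_right (hUU i j))
  let e (a : ∀ i, ZMod (k i)) : N := ((φ a).toMul : Module.End K N) v
  have he0 : e 0 = v := by
    simp only [e, map_zero]
    rfl
  have he (a : ∀ i, ZMod (k i)) (i : Fin s) :
      op (X (Sum.inl i)) • e a = (β i : K) • e (a + Pi.single i 1) := by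
    simp only [e, add_comm a, map_add, hφ, toMul_add, toMul_ofMul, Units.val_mul,
      Module.End.mul_apply, hσ, hU]
    rw [smul_smul, Units.mul_inv, one_smul]
  have heY (i : Fin s) (a : ∀ i, ZMod (k i)) :
      op (Y i) • e a = ((Units.mk0 (μ i) (hμ0 i) * c i ^ ((a i).cast : ℤ) : Kˣ) : K) • e a := by
    refine pi_zmod_induction (P := fun a => op (Y i) • e a =
      ((Units.mk0 (μ i) (hμ0 i) * c i ^ ((a i).cast : ℤ) : Kˣ) : K) • e a) hk (a₀ := 0) ?_ ?_ a
    · simpa [he0] using hμ i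
    · intro a j ha
      have h1 : e (a + Pi.single j 1) = ((β j)⁻¹ : Kˣ).val • op (X (Sum.inl j)) • e a := by
        rw [he, smul_smul, Units.inv_mul, one_smul]
      have h2 : op (Y i) • op (X (Sum.inl j)) • e a =
          ((if j = i then c i else 1 : Kˣ) : K) • op (X (Sum.inl j)) • op (Y i) • e a := by
        rw [smul_smul, smul_smul, ← op_mul, hXY, op_smul, op_mul, smul_assoc]
      have h3 : c i ^ (((a + Pi.single j 1 : ∀ i, ZMod (k i)) i).cast : ℤ) =
          (if j = i then c i else 1) * c i ^ ((a i).cast : ℤ) := by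
        split_ifs with h
        · subst h
          have := zpow_cast_add (hc j) (a j) 1
          rw [Int.cast_one] at this
          rw [Pi.add_apply, Pi.single_eq_same, this, add_comm, zpow_one_add]
        · rw [Pi.add_apply, Pi.single_eq_of_ne (Ne.symm h), add_zero, one_mul]
      rw [h3, h1, smul_comm, h2, ha, smul_comm (op (X (Sum.inl j))), smul_smul, smul_smul,
        smul_smul]
      congr 1
      simp only [Units.val_mul]
      ring
  refine ⟨α, Finsupp.linearCombination K e, fun h => hv ?_, map_blockRep hc α _ fun x a => ?_⟩
  · rw [← he0]
    simpa using LinearMap.congr_fun h (Finsupp.single 0 1)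
  · simp only [Finsupp.linearCombination_single, one_smul]
    rcases x with i | i | j
    · exact (he a i).symm
    -- The formula for `X (i+s)` is checked after applying the injective `X i`, where it becomes the
    -- eigenvalue equation `heY`.
    · have hinj : Function.Injective fun w : N => op (X (Sum.inl i)) • w := fun w w' h =>
        sub_eq_zero.1 (by_contra fun h' => hUne (Sum.inl i) h' (by
          rw [smul_sub, sub_eq_zero]
          exact h))
      apply hinj
      simp only [blockCoeff, blockShift]
      rw [smul_comm, he, add_assoc, ← Pi.single_add, neg_add_cancel, Pi.single_zero, add_zero,
        smul_smul, smul_smul, ← op_mul]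
      rw [heY]
      congr 1
      rw [← Units.val_mul]
      congr 1
      simp only [α, Sum.elim_inl, Sum.elim_inr]
      rw [zpow_sub_one]
      rw [mul_assoc, mul_assoc, inv_mul_eq_iff_eq_mul]
      simp only [mul_comm, mul_left_comm, mul_inv_cancel_left, mul_assoc]
    · have h1 := hl (Sum.inr (Sum.inr j)) (e a)
      simp only [Sum.elim_inr, pow_one] at h1
      simpa [blockCoeff, blockShift, α] using h1.symm

end Intertwiner

/-! ### Models attached to a normal form -/

namespace NormalForm

variable {K : Type u} [Field K] {n : ℕ} {q : Matrix (Fin n) (Fin n) Kˣ} {ζ : Kˣ}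
  (F : NormalForm q ζ)

lemma k_pos (hm : 0 < orderOf ζ) (i : Fin F.s) : 0 < F.k i :=
  Nat.div_pos (Nat.le_of_dvd hm (F.h_dvd_order i)) (Nat.pos_of_dvd_of_pos (F.h_dvd_order i) hm)

lemma orderOf_c (hm : 0 < orderOf ζ) (i : Fin F.s) : orderOf (F.c i) = F.k i := by
  have h := orderOf_pow_of_dvd (Nat.pos_of_dvd_of_pos (F.h_dvd_order i) hm).ne' (F.h_dvd_order i)
  change orderOf (ζ ^ exponent F.h F.z i) = _
  rw [exponent, k, ← h]
  split_ifs with hi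
  · exact F.z_order i hi
  · rfl

lemma idx_injective : Function.Injective F.idx := by
  rintro (i | i | i) (j | j | j) h <;>
    simp only [idx, Sum.inl.injEq, Sum.inr.injEq, Fin.ext_iff] at h ⊢ <;> omega

variable (α : Fin n → Kˣ)

lemma torus_smul_def (a : QuantumTorus q) (v : F.Model α) : op a • v = (F.rep α a).unop v := rfl

lemma extendsAction_model : ExtendsAction q (F.Model α) := fun _ _ => rfl

lemma algebraMap_torus_smul (r : K) (v : F.Model α) :
    op (algebraMap K (QuantumTorus q) r) • v = r • v := by
  rw [torus_smul_def, AlgHom.commutes]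
  rfl

lemma iso_x_smul (x : BlockIndex F.s (n - 2 * F.s)) (v : F.Model α) :
    op (F.iso (QuantumTorus.x _ x)) • v =
      shiftMap (blockCoeff F.k F.c (α ∘ F.idx) x) (blockShift F.k x) v := by
  have h : F.rep α (F.iso (QuantumTorus.x _ x)) =
      blockRep F.k F.c F.c_pow_k (α ∘ F.idx) (QuantumTorus.x _ x) :=
    congrArg (blockRep F.k F.c F.c_pow_k (α ∘ F.idx)) (F.iso.symm_apply_apply _)
  rw [torus_smul_def, h]
  exact blockRep_x_single F.c_pow_k _ x v

instance : Nontrivial (F.Model α) :=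
  inferInstanceAs (Nontrivial ((∀ i, ZMod (F.k i)) →₀ K))

/-- The model is finite-dimensional, so an injective `x i` that preserves a subspace is surjective
on it, and its inverse preserves the subspace as well. Hence submodules over quantum space are torus
submodules, stable under the generators of the normal form. -/
lemma isSimpleModule_affine (hm : 0 < orderOf ζ) :
    IsSimpleModule (QuantumAffine q)ᵐᵒᵖ (F.Model α) := by
  have (i : Fin F.s) : NeZero (F.k i) := ⟨(F.k_pos hm i).ne'⟩
  have : Module.Finite K (F.Model α) :=
    inferInstanceAs (Module.Finite K ((∀ i, ZMod (F.k i)) →₀ K))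
  refine (isSimpleModule_iff _ _).2 { eq_bot_or_eq_top := fun P => ?_ }
  have hPr (r : K) (v : F.Model α) (hv : v ∈ P) : r • v ∈ P := by
    have h1 := P.smul_mem (op (algebraMap K (QuantumAffine q) r)) hv
    rwa [← F.extendsAction_model α, AlgHom.commutes, algebraMap_torus_smul] at h1
  let P' : Submodule K (F.Model α) := { P.toAddSubmonoid with smul_mem' := hPr }
  have hx (i : Fin n) (v : F.Model α) (hv : v ∈ P) : op (QuantumTorus.x q i) • v ∈ P := by
    rw [← toTorus_x, F.extendsAction_model α]
    exact P.smul_mem _ hv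
  have hPa (a : QuantumTorus q) : ∀ v ∈ P, op a • v ∈ P := by
    induction a using QuantumTorus.induction with
    | hK r =>
      intro v hv
      rw [algebraMap_torus_smul]
      exact hPr r v hv
    | hx i => exact hx i
    | hx' i =>
      intro v hv
      let T : Module.End K (F.Model α) := (F.rep α (QuantumTorus.x q i)).unop
      have hTP : ∀ w ∈ P', T w ∈ P' := hx i
      have hinv (w : F.Model α) : op (((QuantumTorus.xUnit q i)⁻¹ : (QuantumTorus q)ˣ) :
          QuantumTorus q) • T w = w := by
        change _ • op (QuantumTorus.x q i) • w = w
        rw [smul_smul, ← op_mul, ← QuantumTorus.val_xUnit, Units.mul_inv, op_one, one_smul]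
      have hinj : Function.Injective (T.restrict hTP) := fun w w' h => Subtype.ext <| by
        rw [← hinv w, ← hinv w']
        exact congrArg _ (congrArg Subtype.val h)
      obtain ⟨w, hw⟩ := LinearMap.injective_iff_surjective.1 hinj ⟨v, hv⟩
      have hw' : T w = v := congrArg Subtype.val hw
      rw [← hw', hinv]
      exact w.2
    | hadd a b ha hb =>
      intro v hv
      rw [op_add, add_smul]
      exact add_mem (ha v hv) (hb v hv)
    | hmul a b ha hb =>
      intro v hv
      rw [op_mul, mul_smul]
      exact hb _ (ha v hv)
  refine (eq_bot_or_eq_top_of_shiftMap_mem (F.k_pos hm) (F.orderOf_c hm) (α ∘ F.idx) P'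
    fun x f hf => ?_).imp (fun h => ?_) fun h => ?_
  · exact F.iso_x_smul α x f ▸ hPa (F.iso (QuantumTorus.x _ x)) f hf
  · exact SetLike.ext fun v => SetLike.ext_iff.1 h v
  · exact SetLike.ext fun v => SetLike.ext_iff.1 h v

lemma variablesActNontrivially : VariablesActNontrivially q (F.Model α) := by
  intro i
  obtain ⟨v, hv⟩ := exists_ne (0 : F.Model α)
  refine ⟨v, fun h => hv ?_⟩
  rw [← F.extendsAction_model α, toTorus_x, ← QuantumTorus.val_xUnit] at h
  have h1 := congrArg (op (((QuantumTorus.xUnit q i)⁻¹ : (QuantumTorus q)ˣ) :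
    QuantumTorus q) • ·) h
  simpa only [smul_smul, ← op_mul, Units.mul_inv, op_one, one_smul, smul_zero] using h1

/-- Every simple module over the quantum torus is isomorphic to one of the models. -/
theorem exists_linearEquiv_model [IsAlgClosed K] (hm : 0 < orderOf ζ) (N : Type*) [AddCommGroup N]
    [Module (QuantumTorus q)ᵐᵒᵖ N] [IsSimpleModule (QuantumTorus q)ᵐᵒᵖ N] :
    ∃ α : Fin n → Kˣ, Nonempty (N ≃ₗ[(QuantumTorus q)ᵐᵒᵖ] F.Model α) := by
  let B := QuantumTorus (blockMatrix (t := n - 2 * F.s) F.c)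
  let : Module Bᵐᵒᵖ N := Module.compHom N (AlgHom.op F.iso.toAlgHom).toRingHom
  have hB (b : B) (v : N) : op b • v = op (F.iso b) • v := rfl
  let : Module K N := Module.compHom N (algebraMap K (QuantumTorus q)ᵐᵒᵖ)
  have hK (r : K) (v : N) : r • v = op (algebraMap K (QuantumTorus q) r) • v := rfl
  have : IsScalarTower K Bᵐᵒᵖ N := ⟨fun r b v => by
    rw [← op_unop b, ← op_smul, hB, hB, hK, map_smul, Algebra.smul_def, Algebra.commutes,
      op_mul, mul_smul]⟩
  have : Nontrivial N := IsSimpleModule.nontrivial (QuantumTorus q)ᵐᵒᵖ N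
  have : IsSimpleModule Bᵐᵒᵖ N := by
    refine (isSimpleModule_iff _ _).2 { eq_bot_or_eq_top := fun P => ?_ }
    let P' : Submodule (QuantumTorus q)ᵐᵒᵖ N :=
      { P.toAddSubmonoid with
        smul_mem' := fun a v hv => by
          have h1 := P.smul_mem (op (F.iso.symm a.unop)) hv
          rwa [hB, F.iso.apply_symm_apply, op_unop] at h1 }
    refine (eq_bot_or_eq_top P').imp (fun h => ?_) fun h => ?_
    · exact SetLike.ext fun v => SetLike.ext_iff.1 h v
    · exact SetLike.ext fun v => SetLike.ext_iff.1 h v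
  obtain ⟨α', g, hg0, hg⟩ := exists_intertwiner (t := n - 2 * F.s) (F.k_pos hm) F.c_pow_k N
  -- The default value 1 plays no role: only the composite `α ∘ F.idx` enters the action.
  let α : Fin n → Kˣ := Function.extend F.idx α' 1
  have hα : α ∘ F.idx = α' := funext fun x => F.idx_injective.extend_apply _ _ _
  rw [← hα] at hg
  let G : F.Model α →ₗ[(QuantumTorus q)ᵐᵒᵖ] N :=
    { toFun := g
      map_add' := g.map_add
      map_smul' := fun a m => by
        have h1 := hg (F.iso.symm a.unop) m
        rw [hB, F.iso.apply_symm_apply, op_unop] at h1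
        exact h1 }
  have hG : G ≠ 0 := fun h => hg0 (LinearMap.ext fun m => LinearMap.congr_fun h m)
  have := F.isSimpleModule_affine α hm
  have := (F.extendsAction_model α).isSimpleModule
  exact ⟨α, ⟨(LinearEquiv.ofBijective G (LinearMap.bijective_of_ne_zero hG)).symm⟩⟩

end NormalForm

end QuantumSpace

end

open QuantumSpace
theorem theoremB {K : Type*} [Field K] [IsAlgClosed K] {n : ℕ} (q : Matrix (Fin n) (Fin n) Kˣ)
    (hq : MultAntisymm q) (hfin : Finite (paramGroup q)) (ζ : Kˣ)
    (hζ : Subgroup.zpowers ζ = paramGroup q) :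
    Nonempty (NormalForm q ζ) ∧
    ∀ F : NormalForm q ζ,
      (∀ (N : Type*) [AddCommGroup N] [Module (QuantumAffine q)ᵐᵒᵖ N]
          [IsSimpleModule (QuantumAffine q)ᵐᵒᵖ N], VariablesActNontrivially q N →
        (∃! _inst : Module (QuantumTorus q)ᵐᵒᵖ N, ExtendsAction q N) ∧
        ∀ [Module (QuantumTorus q)ᵐᵒᵖ N], ExtendsAction q N →
          IsSimpleModule (QuantumTorus q)ᵐᵒᵖ N ∧
          ∃ α : Fin n → Kˣ, Nonempty (N ≃ₗ[(QuantumTorus q)ᵐᵒᵖ] F.Model α)) ∧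
      ∀ α : Fin n → Kˣ, IsSimpleModule (QuantumAffine q)ᵐᵒᵖ (F.Model α) ∧
        VariablesActNontrivially q (F.Model α) := by
  have hm : 0 < orderOf ζ := by
    rw [← hζ] at hfin
    exact orderOf_pos_iff.2 (finite_zpowers.1 hfin)
  refine ⟨nonempty_normalForm hq hfin hζ, fun F => ⟨fun N _ _ _ hN => ⟨?_, fun hext => ?_⟩,
    fun α => ⟨F.isSimpleModule_affine α hm, F.variablesActNontrivially α⟩⟩⟩
  · obtain ⟨M, hM⟩ := exists_extendsAction fun i => bijective_x_smul (hN i)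
    exact ⟨M, hM, fun M' hM' => extendsAction_unique M' M hM' hM⟩
  · have := hext.isSimpleModule
    exact ⟨this, F.exists_linearEquiv_model hm N⟩
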